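/- Let $\mathcal{L}=\mathbb{Z}+\mathbb{Z}i+\mathbb{Z}j+\mathbb{Z}k$ be the ring of Lipschitz quaternions inside the quaternion algebra $D=\left(\frac{-1,-1}{\mathbb{Q}}\right)$. Let $\operatorname{SL}_2(\mathcal{L})$ be the group of matrices in $\operatorname{GL}_2(\mathcal{L})$ whose reduced norm over $\mathbb{Q}$, taken in the central simple algebra $\operatorname{M}_2(D)$, is $1$. For a ring $R$ let $\operatorname{E}_2(R)$ be the subgroup of $\operatorname{GL}_2(R)$ generated by the matrices $E(x)=\begin{pmatrix} x&1\\-1&0\end{pmatrix}$, $x\in R$. For $n\ge 1$ let $\mathrm{Cl}_n$ be the real Clifford algebra generated by $i_1,\dots,i_{n-1}$ with $i_h^2=-1$ and $i_hi_k=-i_ki_h$ for $h\ne k$, and let $\mathrm{Cl}_n(\mathbb{Z})$ be its subring generated by $i_1,\dots,i_{n-1}$. Let $a\mapsto a^*$ be the linear map of $\mathrm{Cl}_n$ that reverses the order of the factors in products of generators. Let $\mathrm{V}^n(\mathbb{R})$ and $\mathrm{V}^n(\mathbb{Z})$ be the $\mathbb{R}$-span and the $\mathbb{Z}$-span of $1,i_1,\dots,i_{n-1}$.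 Let $\Gamma_n(\mathbb{R})$ be the group of all products of invertible elements of $\mathrm{V}^n(\mathbb{R})$, and put $\Gamma_n(\mathbb{Z})=\mathrm{Cl}_n(\mathbb{Z})\cap\Gamma_n(\mathbb{R})$. Let $\operatorname{SL}_+(\Gamma_n(\mathbb{Z}))$ be the set of matrices $\begin{pmatrix} a&b\\c&d\end{pmatrix}$ with $a,b,c,d\in\Gamma_n(\mathbb{Z})\cup\{0\}$, $ad^*-bc^*=1$ and $ab^*,\,cd^*,\,c^*a,\,d^*b\in \mathrm{V}^n(\mathbb{R})$. Let $\operatorname{E}_2(\Gamma_n(\mathbb{Z}))$ be the group generated by the matrices $E(x)$ with $x\in \mathrm{V}^n(\mathbb{Z})$. A group is a non-trivial amalgamated product if it is isomorphic to a free product with amalgamation $G_1 *_H G_2$ along injective homomorphisms $f_1:H\to G_1$ and $f_2:H\to G_2$ neither of which is surjective. Then $\operatorname{E}_2(\mathcal{L})$ is a subgroup of index four in $\operatorname{SL}_2(\mathcal{L})$, and it is a non-trivial amalgamated product. Moreover $\operatorname{SL}_+(\Gamma_4(\mathbb{Z}))$ is a group under matrix multiplication, and $$\operatorname{E}_2(\mathcal{L})\;\cong\;\operatorname{SL}_+(\Gamma_4(\mathbb{Z}))=\operatorname{E}_2(\Gamma_4(\mathbb{Z})).$$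 -/

import Mathlib

open scoped TensorProduct

/-! ### Free products with amalgamation -/

section Amalgam

variable {G₁ G₂ H : Type*} [Group G₁] [Group G₂] [Group H]

/-- The normal subgroup of the free product `G₁ ∗ G₂` generated by the elements
`f₁ h * (f₂ h)⁻¹`, for `h : H`. -/
def amalgamRelations (f₁ : H →* G₁) (f₂ : H →* G₂) : Subgroup (Monoid.Coprod G₁ G₂) :=
  Subgroup.normalClosure
    (Set.range fun h : H => Monoid.Coprod.inl (f₁ h) * (Monoid.Coprod.inr (f₂ h))⁻¹)

instance amalgamRelations_normal (f₁ : H →* G₁) (f₂ : H →* G₂) :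
    (amalgamRelations f₁ f₂).Normal :=
  Subgroup.normalClosure_normal

/-- The quotient of the free product `G₁ ∗ G₂` that identifies `f₁ h` with `f₂ h` for `h : H`.
It is the free product with amalgamation `G₁ ∗_H G₂` when `f₁` and `f₂` are injective. -/
abbrev AmalgamatedProduct (f₁ : H →* G₁) (f₂ : H →* G₂) : Type _ :=
  Monoid.Coprod G₁ G₂ ⧸ amalgamRelations f₁ f₂

end Amalgam

/-- `G` is isomorphic to a free product with amalgamation `G₁ ∗_H G₂` along injective
homomorphisms `f₁ : H → G₁` and `f₂ : H → G₂` neither of which is surjective. -/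
def IsNontrivialAmalgam.{u} (G : Type u) [Group G] : Prop :=
  ∃ (G₁ G₂ H : Type u) (_ : Group G₁) (_ : Group G₂) (_ : Group H)
    (f₁ : H →* G₁) (f₂ : H →* G₂),
    Function.Injective f₁ ∧ Function.Injective f₂ ∧
    ¬ Function.Surjective f₁ ∧ ¬ Function.Surjective f₂ ∧
    Nonempty (G ≃* AmalgamatedProduct f₁ f₂)

/-! ### `2 × 2` matrices over a (not necessarily commutative) ring -/

section Elementary

variable (R : Type*) [Ring R]

/-- The group `GL₂(R)` of invertible `2 × 2` matrices over a ring `R`. -/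
abbrev GL2 : Type _ := (Matrix (Fin 2) (Fin 2) R)ˣ

variable {R}

/-- The invertible matrix `E(x) = (x, 1; -1, 0)`. -/
def matE (x : R) : GL2 R where
  val := !![x, 1; -1, 0]
  inv := !![0, -1; 1, x]
  val_inv := by simp [Matrix.one_fin_two]
  inv_val := by simp [Matrix.one_fin_two]

variable (R)

/-- The group `E₂(R)` generated by the matrices `E(x)`, `x ∈ R`. -/
def E2 : Subgroup (GL2 R) := Subgroup.closure (Set.range (matE (R := R)))

end Elementary

/-! ### The reduced norm on `2 × 2` matrices over the rational quaternions -/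

noncomputable section ReducedNorm

/-- The matrices `i ↦ (I, 0; 0, -I)`, `j ↦ (0, 1; -1, 0)`, `k ↦ (0, I; I, 0)` satisfy the
relations of the quaternions. -/
def quatBasisComplex :
    QuaternionAlgebra.Basis (Matrix (Fin 2) (Fin 2) ℂ) (-1 : ℚ) 0 (-1) where
  i := !![Complex.I, 0; 0, -Complex.I]
  j := !![0, 1; -1, 0]
  k := !![0, Complex.I; Complex.I, 0]
  i_mul_i := by ext a b; fin_cases a <;> fin_cases b <;> simp
  j_mul_j := by ext a b; fin_cases a <;> fin_cases b <;> simp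
  i_mul_j := by ext a b; fin_cases a <;> fin_cases b <;> simp
  j_mul_i := by ext a b; fin_cases a <;> fin_cases b <;> simp

/-- The standard representation of the rational quaternions by `2 × 2` complex matrices. -/
def quatToComplex : Quaternion ℚ →ₐ[ℚ] Matrix (Fin 2) (Fin 2) ℂ :=
  quatBasisComplex.liftHom

theorem quatToComplex_apply (q : Quaternion ℚ) :
    quatToComplex q = !![q.re + q.imI * Complex.I, q.imJ + q.imK * Complex.I;
      -q.imJ + q.imK * Complex.I, q.re - q.imI * Complex.I] := by
  change quatBasisComplex.lift q = _
  ext a b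
  fin_cases a <;> fin_cases b <;>
    simp [QuaternionAlgebra.Basis.lift, quatBasisComplex, Matrix.algebraMap_matrix_apply,
      Rat.smul_def, sub_eq_add_neg]

/-- The induced homomorphism `M₂(ℍ(ℚ)) → M₂(M₂(ℂ)) ≅ M₄(ℂ)`. -/
def matQuatToComplex :
    Matrix (Fin 2) (Fin 2) (Quaternion ℚ) →ₐ[ℚ] Matrix (Fin 2 × Fin 2) (Fin 2 × Fin 2) ℂ :=
  (Matrix.compAlgEquiv (Fin 2) (Fin 2) ℂ ℚ).toAlgHom.comp quatToComplex.mapMatrix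

/-- The `ℂ`-linear extension of `matQuatToComplex`. -/
def splittingHom :
    ℂ ⊗[ℚ] Matrix (Fin 2) (Fin 2) (Quaternion ℚ) →ₐ[ℂ]
      Matrix (Fin 2 × Fin 2) (Fin 2 × Fin 2) ℂ :=
  Algebra.TensorProduct.lift (Algebra.ofId ℂ _) matQuatToComplex
    (fun z _ => Algebra.commutes z _)

theorem splittingHom_tmul (z : ℂ) (m : Matrix (Fin 2) (Fin 2) (Quaternion ℚ)) :
    splittingHom (z ⊗ₜ m) = z • matQuatToComplex m := by
  rw [Algebra.smul_def]
  exact Algebra.TensorProduct.lift_tmul (Algebra.ofId ℂ _) matQuatToComplex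
    (fun z _ => Algebra.commutes z _) z m

theorem quat_span_complex (c : Matrix (Fin 2) (Fin 2) ℂ) :
    ∃ z : Fin 4 → ℂ, ∃ q : Fin 4 → Quaternion ℚ, ∑ t, z t • quatToComplex (q t) = c := by
  refine ⟨![(c 0 0 + c 1 1) / 2, -Complex.I * (c 0 0 - c 1 1) / 2, (c 0 1 - c 1 0) / 2,
    -Complex.I * (c 0 1 + c 1 0) / 2], ![⟨1, 0, 0, 0⟩, ⟨0, 1, 0, 0⟩, ⟨0, 0, 1, 0⟩, ⟨0, 0, 0, 1⟩], ?_⟩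
  ext a b
  fin_cases a <;> fin_cases b <;>
    simp [Fin.sum_univ_four, quatToComplex_apply] <;> ring_nf <;> simp [Complex.I_sq] <;> ring

theorem splittingHom_surjective : Function.Surjective splittingHom := by
  intro M
  have key : ∀ (a b : Fin 2) (c : Matrix (Fin 2) (Fin 2) ℂ),
      ∃ x, splittingHom x = Matrix.compAlgEquiv (Fin 2) (Fin 2) ℂ ℚ (Matrix.single a b c) := by
    intro a b c
    obtain ⟨z, q, h⟩ := quat_span_complex c
    refine ⟨∑ t, z t ⊗ₜ Matrix.single a b (q t), ?_⟩
    rw [map_sum]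
    subst h
    simp only [splittingHom_tmul]
    ext ⟨i, k⟩ ⟨j, l⟩
    by_cases hi : a = i <;> by_cases hj : b = j <;>
      simp [matQuatToComplex, Matrix.sum_apply, Matrix.single, hi, hj]
  choose x hx using key
  refine ⟨∑ a, ∑ b, x a b (Matrix.of fun k l => M (a, k) (b, l)), ?_⟩
  rw [map_sum]
  simp_rw [map_sum, hx]
  ext ⟨i, k⟩ ⟨j, l⟩
  fin_cases i <;> fin_cases j <;> simp [Fin.sum_univ_two, Matrix.single]

theorem splittingHom_bijective : Function.Bijective splittingHom := by
  have h : Module.finrank ℂ (ℂ ⊗[ℚ] Matrix (Fin 2) (Fin 2) (Quaternion ℚ)) =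
      Module.finrank ℂ (Matrix (Fin 2 × Fin 2) (Fin 2 × Fin 2) ℂ) := by
    rw [Module.finrank_baseChange, Module.finrank_matrix, Module.finrank_matrix,
      Quaternion.finrank_eq_four]
    simp
  exact ⟨(LinearMap.injective_iff_surjective_of_finrank_eq_finrank
    (f := splittingHom.toLinearMap) h).2 splittingHom_surjective, splittingHom_surjective⟩

/-- `ℂ` is a splitting field of the central simple `ℚ`-algebra `M₂(ℍ(ℚ))`. -/
def splitting :
    ℂ ⊗[ℚ] Matrix (Fin 2) (Fin 2) (Quaternion ℚ) ≃ₐ[ℂ]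
      Matrix (Fin 2 × Fin 2) (Fin 2 × Fin 2) ℂ :=
  AlgEquiv.ofBijective splittingHom splittingHom_bijective

/-- The reduced norm of `a ∈ M₂(ℍ(ℚ))`: the determinant of the image of `1 ⊗ a` under an
isomorphism of the scalar extension with a full matrix ring. (It does not depend on the chosen
splitting; it is a rational number, here regarded as an element of `ℂ`.) -/
def reducedNorm : Matrix (Fin 2) (Fin 2) (Quaternion ℚ) →* ℂ where
  toFun a := (splitting (1 ⊗ₜ a)).det
  map_one' := by
    rw [← Algebra.TensorProduct.one_def, map_one, Matrix.det_one]
  map_mul' a b := by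
    rw [← Matrix.det_mul, ← map_mul, Algebra.TensorProduct.tmul_mul_tmul, one_mul]

end ReducedNorm

/-! ### The Lipschitz quaternions and their special linear group -/

/-- The Lipschitz quaternions `ℤ + ℤi + ℤj + ℤk`. -/
abbrev LipschitzQuaternion : Type := Quaternion ℤ

/-- The rational quaternion with the same coordinates as a given Lipschitz quaternion. -/
def LipschitzQuaternion.castRat (q : LipschitzQuaternion) : Quaternion ℚ :=
  ⟨q.re, q.imI, q.imJ, q.imK⟩

section Cast

variable (q : LipschitzQuaternion)

theorem LipschitzQuaternion.re_castRat : (LipschitzQuaternion.castRat q).re = q.re := rfl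

theorem LipschitzQuaternion.imI_castRat : (LipschitzQuaternion.castRat q).imI = q.imI := rfl

theorem LipschitzQuaternion.imJ_castRat : (LipschitzQuaternion.castRat q).imJ = q.imJ := rfl

theorem LipschitzQuaternion.imK_castRat : (LipschitzQuaternion.castRat q).imK = q.imK := rfl

end Cast

/-- The inclusion of the Lipschitz quaternions in the rational quaternions. -/
def LipschitzQuaternion.toRat : LipschitzQuaternion →+* Quaternion ℚ where
  toFun := LipschitzQuaternion.castRat
  map_one' := Quaternion.ext _ _ Int.cast_one Int.cast_zero Int.cast_zero Int.cast_zero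
  map_zero' := Quaternion.ext _ _ Int.cast_zero Int.cast_zero Int.cast_zero Int.cast_zero
  map_add' a b :=
    Quaternion.ext _ _ (Int.cast_add _ _) (Int.cast_add _ _) (Int.cast_add _ _) (Int.cast_add _ _)
  map_mul' a b := by
    apply Quaternion.ext <;>
      simp only [Quaternion.re_mul, Quaternion.imI_mul, Quaternion.imJ_mul, Quaternion.imK_mul,
        LipschitzQuaternion.re_castRat, LipschitzQuaternion.imI_castRat,
        LipschitzQuaternion.imJ_castRat, LipschitzQuaternion.imK_castRat,
        Int.cast_add, Int.cast_sub, Int.cast_mul]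

/-- `SL₂` of the Lipschitz quaternions: the invertible matrices over the Lipschitz quaternions
whose reduced norm, in the `2 × 2` matrices over the rational quaternions, is `1`. -/
noncomputable def SL2Lipschitz : Subgroup (GL2 LipschitzQuaternion) :=
  (Units.map (reducedNorm.comp
    (LipschitzQuaternion.toRat.mapMatrix (m := Fin 2) : _ →* _))).ker

theorem mem_SL2Lipschitz (u : GL2 LipschitzQuaternion) :
    u ∈ SL2Lipschitz ↔
      reducedNorm ((u : Matrix (Fin 2) (Fin 2) LipschitzQuaternion).map
        LipschitzQuaternion.toRat) = 1 := by
  rw [SL2Lipschitz, MonoidHom.mem_ker, Units.ext_iff]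
  rfl

/-! ### Clifford algebras and Clifford groups -/

noncomputable section Clifford

/-- The real Clifford algebra with generators `i₁, …, iₙ₋₁` (indexed by `Fin (n - 1)`) such that
`i_h ^ 2 = -1` and `i_h * i_k = -i_k * i_h` for `h ≠ k`; only `n ≥ 1` is meaningful. -/
abbrev Cliff (n : ℕ) : Type :=
  CliffordAlgebra (QuadraticMap.weightedSumSquares ℝ (fun _ : Fin (n - 1) => (-1 : ℝ)))

/-- The generators `i_h` of the Clifford algebra. -/
def cliffGen (n : ℕ) (h : Fin (n - 1)) : Cliff n :=
  CliffordAlgebra.ι _ (Pi.single h 1)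

/-- The elements `1, i₁, …, iₙ₋₁`. -/
def cliffVecBasis (n : ℕ) : Set (Cliff n) := insert 1 (Set.range (cliffGen n))

/-- The space `Vⁿ(ℝ)` of vectors, spanned over `ℝ` by `1, i₁, …, iₙ₋₁`. -/
def cliffVec (n : ℕ) : Submodule ℝ (Cliff n) := Submodule.span ℝ (cliffVecBasis n)

/-- The lattice `Vⁿ(ℤ)` of integral vectors, spanned over `ℤ` by `1, i₁, …, iₙ₋₁`. -/
def cliffVecInt (n : ℕ) : Submodule ℤ (Cliff n) := Submodule.span ℤ (cliffVecBasis n)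

/-- The integral Clifford algebra: the subring of the real Clifford algebra generated by
`i₁, …, iₙ₋₁`. -/
def CliffInt (n : ℕ) : Subring (Cliff n) := Subring.closure (Set.range (cliffGen n))

/-- The real Clifford group `Γₙ(ℝ)`: all products of invertible elements of `Vⁿ(ℝ)`. -/
def cliffGroup (n : ℕ) : Subgroup (Cliff n)ˣ :=
  Subgroup.closure {u | (u : Cliff n) ∈ cliffVec n}

/-- `Γₙ(ℝ)` as a subset of the Clifford algebra. -/
def GammaReal (n : ℕ) : Set (Cliff n) := Units.val '' (cliffGroup n : Set (Cliff n)ˣ)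

/-- `Γₙ(ℤ)`: the elements of the integral Clifford algebra that lie in `Γₙ(ℝ)`. -/
def GammaInt (n : ℕ) : Set (Cliff n) := (CliffInt n : Set (Cliff n)) ∩ GammaReal n

/-- The set of matrices `GL(Γₙ(ℝ))`. Here `CliffordAlgebra.reverse` is the anti-involution
`a ↦ a*` that reverses the order of the factors in products of generators. -/
def GLGamma (n : ℕ) : Set (Matrix (Fin 2) (Fin 2) (Cliff n)) :=
  {M | (∀ s t, M s t ∈ insert 0 (GammaReal n)) ∧
    (∃ r : ℝ, r ≠ 0 ∧
      M 0 0 * CliffordAlgebra.reverse (M 1 1) - M 0 1 * CliffordAlgebra.reverse (M 1 0) =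
        algebraMap ℝ (Cliff n) r) ∧
    M 0 0 * CliffordAlgebra.reverse (M 0 1) ∈ cliffVec n ∧
    M 1 0 * CliffordAlgebra.reverse (M 1 1) ∈ cliffVec n ∧
    CliffordAlgebra.reverse (M 1 0) * M 0 0 ∈ cliffVec n ∧
    CliffordAlgebra.reverse (M 1 1) * M 0 1 ∈ cliffVec n}

/-- The set of matrices `SL₊(Γₙ(ℝ))`: those matrices of `GL(Γₙ(ℝ))` with `ad* - bc* = 1`. -/
def SLplusGammaReal (n : ℕ) : Set (Matrix (Fin 2) (Fin 2) (Cliff n)) :=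
  {M | M ∈ GLGamma n ∧
    M 0 0 * CliffordAlgebra.reverse (M 1 1) - M 0 1 * CliffordAlgebra.reverse (M 1 0) = 1}

/-- The set of matrices `SL₊(Γₙ(ℤ))`: those matrices of `SL₊(Γₙ(ℝ))` with all entries in
`Γₙ(ℤ) ∪ {0}`. -/
def SLplusGammaInt (n : ℕ) : Set (Matrix (Fin 2) (Fin 2) (Cliff n)) :=
  {M | M ∈ SLplusGammaReal n ∧ ∀ s t, M s t ∈ insert 0 (GammaInt n)}

/-- The group `E₂(Γₙ(ℤ))` generated by the matrices `E(x)`, `x ∈ Vⁿ(ℤ)`. -/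
def E2Gamma (n : ℕ) : Subgroup (GL2 (Cliff n)) :=
  Subgroup.closure (matE '' (cliffVecInt n : Set (Cliff n)))

end Clifford

/-! Index. The Lipschitz quaternions are almost Euclidean: rounding a quotient gives a remainder of
norm at most that of the divisor, with equality only if the divisor has even norm. Two elements of
even norm lie in the kernel of the ring homomorphism `parity` onto the field with two elements, so
they never form a column of an invertible matrix. The Euclidean algorithm therefore works on
columns, and every invertible matrix is elementary up to some diag(u, 1), where u is one of ±1, ±i,
±j, ±k. Since diag(u, 1) has reduced norm 1, SL₂ is all of GL₂. Modulo 2 the Lipschitz quaternions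
commute, so there is a determinant `detModTwo`. It is trivial on elementary matrices and separates
1, i, j, k, while diag(-1, 1) is elementary. Hence its kernel is E₂ (`ker_detModTwo`) and its image
has order 4.

Amalgam. Hermitian forms (a, q; star q, b) form a lattice of signature (5, 1) under N(q) - ab, and
those of discriminant 1 are oriented hyperplanes of hyperbolic 5-space. The elementary group
preserves the forms with a, b even and q ≡ k modulo 2. The Lorentzian product of two of them is odd,
hence of absolute value at least 1, so the hyperplanes are equal or disjoint (`wallForms_nested`).
Such an arrangement is dual to a tree. The element `sideSwap` exchanges the two sides of a base
wall, and together with the stabilizer of an adjacent chamber it generates the group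
(`closure_sideSwap_chamberStabilizer`). The group is then the amalgam of the chamber stabilizer and
the stabilizer of the unoriented wall over the stabilizer of the oriented wall. The tree itself is
not constructed: forms are ordered pointwise as functions on vectors, which is inclusion of
half-spaces, and the ping-pong argument of `isNontrivialAmalgam_of_action` uses this order.

Clifford groups. The algebra Cl₄ is ℍ × ℍ. There vectors are the pairs (p, star p), integral
elements are the pairs of Lipschitz quaternions congruent modulo 2, elements of Γ₄(ℝ) ∪ {0} are the
pairs of equal norm, and reversal is (p, q) ↦ (star q, star p). A matrix in SL₊ thus becomes a pair
(X, Y) in which X determines Y as a twisted inverse. The congruence X ≡ Y modulo 2 forces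
determinant 1 modulo 2, so X is elementary by `ker_detModTwo`. Conversely, for elementary X an
induction over the generators gives the congruence and the equality of norms
(`rowCompatible_of_mem_E2`). -/

/-! ### A criterion for amalgamated products -/

section AmalgamCriterion

namespace AmalgamatedProduct

variable {G₁ G₂ H : Type*} [Group G₁] [Group G₂] [Group H] (f₁ : H →* G₁) (f₂ : H →* G₂)

/-- The homomorphism out of an amalgamated product induced by two compatible homomorphisms. -/
def lift {K : Type*} [Group K] (g₁ : G₁ →* K)
    (g₂ : G₂ →* K) (h : ∀ x, g₁ (f₁ x) = g₂ (f₂ x)) : AmalgamatedProduct f₁ f₂ →* K :=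
  QuotientGroup.lift _ (Monoid.Coprod.lift g₁ g₂) (by
    change amalgamRelations f₁ f₂ ≤ (Monoid.Coprod.lift g₁ g₂).ker
    refine Subgroup.normalClosure_le_normal ?_
    rintro _ ⟨x, rfl⟩
    simp [MonoidHom.mem_ker, h])

/-- The homomorphism from the first factor to the amalgamated product. -/
def inl : G₁ →* AmalgamatedProduct f₁ f₂ := (QuotientGroup.mk' _).comp Monoid.Coprod.inl

/-- The homomorphism from the second factor to the amalgamated product. -/
def inr : G₂ →* AmalgamatedProduct f₁ f₂ := (QuotientGroup.mk' _).comp Monoid.Coprod.inr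

theorem inl_eq_inr (x : H) : inl f₁ f₂ (f₁ x) = inr f₁ f₂ (f₂ x) := by
  rw [← mul_inv_eq_one, ← map_inv]
  change ((Monoid.Coprod.inl (f₁ x) * Monoid.Coprod.inr (f₂ x)⁻¹ : Monoid.Coprod G₁ G₂) :
    AmalgamatedProduct f₁ f₂) = 1
  rw [QuotientGroup.eq_one_iff, map_inv]
  exact Subgroup.subset_normalClosure ⟨x, rfl⟩

variable {f₁ f₂}

theorem lift_inl {K : Type*} [Group K] (g₁ : G₁ →* K)
    (g₂ : G₂ →* K) (h : ∀ x, g₁ (f₁ x) = g₂ (f₂ x)) (x : G₁) :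
    lift f₁ f₂ g₁ g₂ h (inl f₁ f₂ x) = g₁ x := rfl

theorem lift_inr {K : Type*} [Group K] (g₁ : G₁ →* K)
    (g₂ : G₂ →* K) (h : ∀ x, g₁ (f₁ x) = g₂ (f₂ x)) (x : G₂) :
    lift f₁ f₂ g₁ g₂ h (inr f₁ f₂ x) = g₂ x := rfl

theorem induction {P : AmalgamatedProduct f₁ f₂ → Prop} (one : P 1)
    (inl_mul : ∀ g x, P x → P (inl f₁ f₂ g * x)) (inr_mul : ∀ g x, P x → P (inr f₁ f₂ g * x))
    (a : AmalgamatedProduct f₁ f₂) : P a := by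
  induction a using QuotientGroup.induction_on with
  | H z =>
    induction z using Monoid.Coprod.induction_on' with
    | one => exact one
    | inl_mul m x hx => exact inl_mul m x hx
    | inr_mul m x hx => exact inr_mul m x hx

end AmalgamatedProduct

variable {G X : Type*} [Group G] [MulAction G X] [InvolutiveNeg X]

/-- The elements of `G` that map `v` to `v` or `-v`. -/
def negStabilizer (hneg : ∀ (g : G) (x : X), g • (-x) = -(g • x)) (v : X) : Subgroup G where
  carrier := {g | g • v = v ∨ g • v = -v}
  one_mem' := Or.inl (one_smul _ _)
  mul_mem' := by
    rintro a b (ha | ha) (hb | hb) <;> simp [mul_smul, hb, hneg, ha]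
  inv_mem' := by
    rintro a (ha | ha)
    · exact Or.inl (by rw [inv_smul_eq_iff, ha])
    · exact Or.inr (by rw [inv_smul_eq_iff, hneg, ha, neg_neg])

/-- The words `s g₁ s g₂ ⋯ s gₙ` with `gₙ` arbitrary in the first factor and the other `gᵢ` in the
first factor, but not in the amalgamated subgroup. -/
inductive IsAlternatingWord {G₁ G₂ H : Type*} [Group G₁] [Group G₂] [Group H] (f₁ : H →* G₁)
    (f₂ : H →* G₂) (s : G₂) : AmalgamatedProduct f₁ f₂ → Prop
  | base (g : G₁) : IsAlternatingWord f₁ f₂ s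
      (AmalgamatedProduct.inr f₁ f₂ s * AmalgamatedProduct.inl f₁ f₂ g)
  | step (g : G₁) (b : AmalgamatedProduct f₁ f₂) (hg : g ∉ f₁.range)
      (hb : IsAlternatingWord f₁ f₂ s b) : IsAlternatingWord f₁ f₂ s
      (AmalgamatedProduct.inr f₁ f₂ s * (AmalgamatedProduct.inl f₁ f₂ g * b))

open AmalgamatedProduct in
/-- If the second factor is the union of the amalgamated subgroup and its coset of `s`, then each
element of the amalgamated product lies in the first factor or is a product of an element of
the first factor and an alternating word. -/
theorem AmalgamatedProduct.exists_alternatingWord {G₁ G₂ H : Type*} [Group G₁] [Group G₂] [Group H]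
    {f₁ : H →* G₁} {f₂ : H →* G₂} {s : G₂} (h₂ : ∀ g, g ∈ f₂.range ∨ s⁻¹ * g ∈ f₂.range)
    (hss : s * s ∈ f₂.range) (hn : ∀ h ∈ f₂.range, s * h * s⁻¹ ∈ f₂.range)
    (a : AmalgamatedProduct f₁ f₂) :
    (∃ g, a = inl f₁ f₂ g) ∨ ∃ g b, IsAlternatingWord f₁ f₂ s b ∧ a = inl f₁ f₂ g * b := by
  have hl : ∀ g (x : AmalgamatedProduct f₁ f₂),
      ((∃ g, x = inl f₁ f₂ g) ∨ ∃ g b, IsAlternatingWord f₁ f₂ s b ∧ x = inl f₁ f₂ g * b) →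
      ((∃ g', inl f₁ f₂ g * x = inl f₁ f₂ g') ∨
        ∃ g' b, IsAlternatingWord f₁ f₂ s b ∧ inl f₁ f₂ g * x = inl f₁ f₂ g' * b) := by
    rintro g x (⟨g', rfl⟩ | ⟨g', b, hb, rfl⟩)
    · exact Or.inl ⟨g * g', by rw [map_mul]⟩
    · exact Or.inr ⟨g * g', b, hb, by rw [map_mul, mul_assoc]⟩
  have hs : ∀ x : AmalgamatedProduct f₁ f₂,
      ((∃ g, x = inl f₁ f₂ g) ∨ ∃ g b, IsAlternatingWord f₁ f₂ s b ∧ x = inl f₁ f₂ g * b) →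
      ((∃ g', inr f₁ f₂ s * x = inl f₁ f₂ g') ∨
        ∃ g' b, IsAlternatingWord f₁ f₂ s b ∧ inr f₁ f₂ s * x = inl f₁ f₂ g' * b) := by
    rintro x (⟨g', rfl⟩ | ⟨g', b, hb, rfl⟩)
    · exact Or.inr ⟨1, _, .base g', by rw [map_one, one_mul]⟩
    · by_cases hg : g' ∈ f₁.range
      · obtain ⟨h, rfl⟩ := hg
        obtain ⟨h', hh'⟩ : s * f₂ h * s ∈ f₂.range := by
          have := mul_mem (hn _ ⟨h, rfl⟩) hss
          rwa [← mul_assoc, inv_mul_cancel_right] at this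
        -- A letter of the amalgamated subgroup between two letters `s` is absorbed: `s h s` lies in
        -- the amalgamated subgroup again, so both letters `s` disappear.
        have key : ∀ c : AmalgamatedProduct f₁ f₂,
            inr f₁ f₂ s * (inl f₁ f₂ (f₁ h) * (inr f₁ f₂ s * c)) = inl f₁ f₂ (f₁ h') * c := by
          intro c
          rw [inl_eq_inr, inl_eq_inr, hh', map_mul, map_mul, mul_assoc, mul_assoc]
        cases hb with
        | base g => exact Or.inl ⟨f₁ h' * g, by rw [key, map_mul]⟩
        | step g b hg hb => exact Or.inr ⟨f₁ h' * g, b, hb, by rw [key, map_mul, mul_assoc]⟩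
      · exact Or.inr ⟨1, _, .step g' b hg hb, by rw [map_one, one_mul]⟩
  induction a using AmalgamatedProduct.induction with
  | one => exact Or.inl ⟨1, (map_one _).symm⟩
  | inl_mul g x hx => exact hl g x hx
  | inr_mul g x hx =>
    rcases h₂ g with ⟨h, rfl⟩ | ⟨h, hh⟩
    · rw [← inl_eq_inr]
      exact hl _ _ hx
    · obtain rfl : g = s * f₂ h := by rw [hh, mul_inv_cancel_left]
      rw [map_mul, mul_assoc, ← inl_eq_inr]
      exact hs _ (hl _ _ hx)

open AmalgamatedProduct in
/-- A group that acts on an ordered set with an involution is a non-trivial amalgamated product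
if it is generated by an element `s` that maps `v` to `-v` and by a subgroup that contains the
stabilizer of `v` properly and whose elements outside of this stabilizer map `v` to an
element above `-v`. -/
theorem isNontrivialAmalgam_of_action.{u} {G : Type u} {X : Type*} [Group G] [MulAction G X]
    [PartialOrder X] [InvolutiveNeg X] (hmono : ∀ (g : G) (x y : X), x ≤ y → g • x ≤ g • y)
    (hanti : ∀ x y : X, x ≤ y → -y ≤ -x)
    (hneg : ∀ (g : G) (x : X), g • (-x) = -(g • x)) (v : X) (hv : ¬ v ≤ -v) (s : G) (hs : s • v = -v) (G₁ : Subgroup G)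
    (hG₁ : ∀ g ∈ G₁, g • v = v ∨ -v < g • v) (hH : MulAction.stabilizer G v ≤ G₁)
    (hne : ∃ g ∈ G₁, g • v ≠ v) (htop : Subgroup.closure (insert s (G₁ : Set G)) = ⊤) :
    IsNontrivialAmalgam G := by
  have hvne : v ≠ -v := fun h => hv h.le
  let H := MulAction.stabilizer G v
  let G₂ := negStabilizer hneg v
  have hH₂ : H ≤ G₂ := fun g hg => Or.inl hg
  let f₁ := Subgroup.inclusion hH
  let f₂ := Subgroup.inclusion hH₂
  have mem₁ : ∀ g : G₁, g ∈ f₁.range ↔ (g : G) • v = v := fun g =>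
    ⟨by rintro ⟨h, rfl⟩; exact h.2, fun h => ⟨⟨g, h⟩, rfl⟩⟩
  have mem₂ : ∀ g : G₂, g ∈ f₂.range ↔ (g : G) • v = v := fun g =>
    ⟨by rintro ⟨h, rfl⟩; exact h.2, fun h => ⟨⟨g, h⟩, rfl⟩⟩
  let s₂ : G₂ := ⟨s, Or.inr hs⟩
  have hs' : s⁻¹ • v = -v := by rw [inv_smul_eq_iff, hneg, hs, neg_neg]
  let F := AmalgamatedProduct.lift f₁ f₂ G₁.subtype G₂.subtype fun _ => rfl
  have hF₁ : ∀ g, F (inl f₁ f₂ g) = g := fun g => lift_inl _ _ _ g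
  have hF₂ : ∀ g, F (inr f₁ f₂ g) = g := fun g => lift_inr _ _ _ g
  -- Ping-pong. Translates of `v` by elements of `G₁` outside of the stabilizer lie above `-v`, so
  -- such an element moves everything below `-v` to something below `v`, and `s` brings it back
  -- below `-v`. The factor `g` cancels the last letter of the word.
  have hword : ∀ b, IsAlternatingWord f₁ f₂ s₂ b → ∃ g : G₁, (F b * g) • v ≤ -v := by
    intro b hb
    induction hb with
    | base g =>
      refine ⟨g⁻¹, ?_⟩
      rw [map_mul, hF₁, hF₂, InvMemClass.coe_inv, mul_inv_cancel_right]
      exact hs.le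
    | step g b hg hb ih =>
      obtain ⟨g', hg'⟩ := ih
      refine ⟨g', ?_⟩
      rw [map_mul, map_mul, hF₁, hF₂, mul_assoc, mul_assoc, mul_smul, mul_smul]
      have h1 := hmono g _ _ hg'
      have h2 : -v < (g : G) • v := (hG₁ g g.2).resolve_left fun h => hg ((mem₁ g).2 h)
      have h3 := hmono s _ _ (h1.trans ((hneg _ _).le.trans (hanti _ _ h2.le)))
      rwa [neg_neg, hs] at h3
  have hF : Function.Bijective F := by
    constructor
    · rw [injective_iff_map_eq_one]
      intro a ha
      have hcases := exists_alternatingWord (f₁ := f₁) (f₂ := f₂) (s := s₂) (fun g => by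
        rw [mem₂, mem₂]
        refine g.2.imp id fun h => ?_
        change (s⁻¹ * (g : G)) • v = v
        rw [mul_smul, h, hneg, hs', neg_neg]) (by
        rw [mem₂]
        change (s * s) • v = v
        rw [mul_smul, hs, hneg, hs, neg_neg]) (fun h hh => by
        rw [mem₂] at hh ⊢
        change (s * (h : G) * s⁻¹) • v = v
        rw [mul_smul, mul_smul, hs', hneg, hh, hneg, hs, neg_neg]) a
      rcases hcases with ⟨g, rfl⟩ | ⟨g, b, hb, rfl⟩
      · rw [hF₁] at ha
        rw [show g = 1 from Subtype.ext ha, map_one]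
      · exfalso
        obtain ⟨g', hg'⟩ := hword b hb
        -- If the whole product is trivial, the word equals `g⁻¹` in the group, so an element of
        -- `G₁` maps `v` to something below `-v`, which `hG₁` and `hv` exclude.
        rw [map_mul, hF₁, ← eq_inv_iff_mul_eq_one, ← inv_eq_iff_eq_inv] at ha
        rw [← ha] at hg'
        rcases hG₁ _ (mul_mem (inv_mem g.2) g'.2) with h | h
        · rw [h] at hg'
          exact hv hg'
        · exact (h.trans_le hg').false
    · rw [← MonoidHom.range_eq_top, eq_top_iff, ← htop, Subgroup.closure_le]
      rintro g (rfl | hg)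
      · exact ⟨inr f₁ f₂ s₂, hF₂ _⟩
      · exact ⟨inl f₁ f₂ ⟨g, hg⟩, hF₁ _⟩
  refine ⟨G₁, G₂, H, inferInstance, inferInstance, inferInstance, f₁, f₂,
    Subgroup.inclusion_injective _, Subgroup.inclusion_injective _, ?_, ?_,
    ⟨(MulEquiv.ofBijective F hF).symm⟩⟩
  · intro h
    obtain ⟨g, hg, hgv⟩ := hne
    obtain ⟨x, hx⟩ := h ⟨g, hg⟩
    exact hgv ((mem₁ ⟨g, hg⟩).1 ⟨x, hx⟩)
  · intro h
    obtain ⟨x, hx⟩ := h s₂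
    exact hvne (((mem₂ s₂).1 ⟨x, hx⟩).symm.trans hs)

end AmalgamCriterion

/-! ### Elementary matrices -/

section ElementaryMatrices

variable {R : Type*} [Ring R]

/-- Inverses of generators are products of generators, so inductions over E₂ only need
multiplication by some E(x). -/
theorem matE_inv (x : R) : (matE x)⁻¹ = matE 0 * matE (-x) * matE 0 := by
  ext i j
  change (!![0, -1; 1, x] : Matrix (Fin 2) (Fin 2) R) i j =
    (!![0, 1; -1, 0] * !![-x, 1; -1, 0] * !![0, 1; -1, 0] : Matrix (Fin 2) (Fin 2) R) i j
  fin_cases i <;> fin_cases j <;> simp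

theorem matE_mem (x : R) : matE x ∈ E2 R := Subgroup.subset_closure ⟨x, rfl⟩

theorem coe_matE (x : R) : (matE x : Matrix (Fin 2) (Fin 2) R) = !![x, 1; -1, 0] := rfl

/-- Induction over the elements of `E₂(R)`, by multiplication with generators on the right. -/
theorem E2_induction {P : GL2 R → Prop} (one : P 1) (mul : ∀ g x, P g → P (g * matE x))
    {g : GL2 R} (hg : g ∈ E2 R) : P g := by
  induction hg using Subgroup.closure_induction_right with
  | one => exact one
  | mul_right g y hg hy ih =>
    obtain ⟨x, rfl⟩ := hy
    exact mul g x ih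
  | mul_inv_cancel g y hg hy ih =>
    obtain ⟨x, rfl⟩ := hy
    rw [matE_inv, ← mul_assoc, ← mul_assoc]
    exact mul _ _ (mul _ _ (mul _ _ ih))

/-- The diagonal matrix `(u, 0; 0, v)`. -/
def diagGL2 (u v : Rˣ) : GL2 R where
  val := !![(u : R), 0; 0, (v : R)]
  inv := !![((u⁻¹ : Rˣ) : R), 0; 0, ((v⁻¹ : Rˣ) : R)]
  val_inv := by simp [Matrix.one_fin_two]
  inv_val := by simp [Matrix.one_fin_two]

theorem coe_diagGL2 (u v : Rˣ) :
    (diagGL2 u v : Matrix (Fin 2) (Fin 2) R) = !![(u : R), 0; 0, (v : R)] := rfl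

theorem diagGL2_mul (u v u' v' : Rˣ) :
    diagGL2 u v * diagGL2 u' v' = diagGL2 (u * u') (v * v') := by
  apply Units.ext
  simp [coe_diagGL2]

/-- The upper triangular matrix `(1, x; 0, 1)`. -/
def unipGL2 (x : R) : GL2 R where
  val := !![1, x; 0, 1]
  inv := !![1, -x; 0, 1]
  val_inv := by simp [Matrix.one_fin_two]
  inv_val := by simp [Matrix.one_fin_two]

theorem coe_unipGL2 (x : R) :
    (unipGL2 x : Matrix (Fin 2) (Fin 2) R) = !![1, x; 0, 1] := rfl

theorem matE_mul_matE_zero (x : R) : matE x * matE 0 = diagGL2 (-1) (-1) * unipGL2 (-x) := by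
  apply Units.ext
  simp [coe_diagGL2, coe_matE, coe_unipGL2]

theorem matE_zero_mul_self : matE (0 : R) * matE 0 = diagGL2 (-1) (-1) := by
  apply Units.ext
  simp [coe_diagGL2, coe_matE]

theorem unipGL2_mem (x : R) : unipGL2 x ∈ E2 R := by
  have h := matE_mul_matE_zero (-x)
  rw [neg_neg, ← matE_zero_mul_self] at h
  rw [← inv_mul_eq_iff_eq_mul.2 h]
  exact mul_mem (inv_mem (mul_mem (matE_mem _) (matE_mem _)))
    (mul_mem (matE_mem _) (matE_mem _))

theorem diagGL2_inv_mem (u : Rˣ) : diagGL2 u u⁻¹ ∈ E2 R := by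
  have h : diagGL2 u u⁻¹ = matE 0 * matE 0 * (matE (u : R) * matE ((u⁻¹ : Rˣ) : R) * matE (u : R)) := by
    apply Units.ext
    simp [coe_diagGL2, coe_matE]
  rw [h]
  exact mul_mem (mul_mem (matE_mem _) (matE_mem _))
    (mul_mem (mul_mem (matE_mem _) (matE_mem _)) (matE_mem _))

/-- An upper triangular invertible matrix with invertible diagonal entries is the product of an
elementary matrix and a diagonal one. -/
theorem exists_mul_diagGL2_mem (M : GL2 R) (u v : Rˣ) (b : R)
    (hM : (M : Matrix (Fin 2) (Fin 2) R) = !![(u : R), b; 0, (v : R)]) :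
    ∃ w : Rˣ, M * diagGL2 w 1 ∈ E2 R := by
  -- This choice turns the diagonal into (v⁻¹, v), and matrices diag(u, u⁻¹) are elementary.
  refine ⟨u⁻¹ * v⁻¹, ?_⟩
  have h : M * diagGL2 (u⁻¹ * v⁻¹) 1 = unipGL2 (b * ↑v⁻¹) * diagGL2 v⁻¹ v⁻¹⁻¹ := by
    apply Units.ext
    simp [coe_diagGL2, hM, coe_unipGL2]
  rw [h]
  exact mul_mem (unipGL2_mem _) (diagGL2_inv_mem _)

end ElementaryMatrices

/-! ### Lipschitz quaternions -/

namespace LipschitzQuaternion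

open Quaternion

theorem normSq_nonneg (q : LipschitzQuaternion) : 0 ≤ normSq q := by
  rw [normSq_def']; positivity

theorem normSq_eq_zero {q : LipschitzQuaternion} : normSq q = 0 ↔ q = 0 := by
  refine ⟨fun h => ?_, fun h => by rw [h, map_zero]⟩
  rw [normSq_def'] at h
  ext <;> simp only [re_zero, imI_zero, imJ_zero, imK_zero] <;> nlinarith [sq_nonneg q.re, sq_nonneg q.imI, sq_nonneg q.imJ, sq_nonneg q.imK]

theorem exists_two_mul_abs_le (m N : ℤ) (hN : 0 < N) : ∃ t : ℤ, 2 * |m + t * N| ≤ N := by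
  -- Rounding to the nearest integer: the quotient is the floor of m/N + 1/2.
  refine ⟨-((2 * m + N) / (2 * N)), ?_⟩
  have h1 := Int.emod_add_mul_ediv (2 * m + N) (2 * N)
  have h2 := Int.emod_nonneg (2 * m + N) (by omega : 2 * N ≠ 0)
  have h3 := Int.emod_lt_of_pos (2 * m + N) (by omega : 0 < 2 * N)
  set q := (2 * m + N) / (2 * N)
  have h4 : 2 * (m + -q * N) = (2 * m + N) % (2 * N) - N := by linear_combination -h1
  have h5 : |2 * (m + -q * N)| ≤ N := by
    rw [h4, abs_le]
    constructor <;> linarith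
  rwa [abs_mul, abs_two] at h5

/-- Division with remainder of Lipschitz quaternions. -/
theorem exists_normSq_add_mul_lt (a c : LipschitzQuaternion) (ha : a ≠ 0) :
    ∃ t, normSq (c + t * a) < normSq a ∨ (Even (normSq a) ∧ normSq (c + t * a) = normSq a) := by
  have hN : 0 < normSq a := lt_of_le_of_ne (normSq_nonneg a) fun h => ha (normSq_eq_zero.1 h.symm)
  set N := normSq a with hNdef
  obtain ⟨t₀, h₀⟩ := exists_two_mul_abs_le (c * star a).re N hN
  obtain ⟨t₁, h₁⟩ := exists_two_mul_abs_le (c * star a).imI N hN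
  obtain ⟨t₂, h₂⟩ := exists_two_mul_abs_le (c * star a).imJ N hN
  obtain ⟨t₃, h₃⟩ := exists_two_mul_abs_le (c * star a).imK N hN
  obtain ⟨t, r₀, r₁, r₂, r₃⟩ : ∃ t : LipschitzQuaternion,
      t.re = t₀ ∧ t.imI = t₁ ∧ t.imJ = t₂ ∧ t.imK = t₃ := ⟨⟨t₀, t₁, t₂, t₃⟩, rfl, rfl, rfl, rfl⟩
  refine ⟨t, ?_⟩
  have hs : (c + t * a) * star a = c * star a + t * (N : ℤ) := by
    rw [add_mul, mul_assoc, self_mul_star, hNdef]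
    rfl
  -- Multiplying by `star a` turns the division by `a` into a division by the integer `N`, done in
  -- each coordinate. Each of the four squares is at most N²/4.
  have hprod : normSq (c + t * a) * N = ((c * star a).re + t₀ * N) ^ 2 +
      ((c * star a).imI + t₁ * N) ^ 2 + ((c * star a).imJ + t₂ * N) ^ 2 +
      ((c * star a).imK + t₃ * N) ^ 2 := by
    rw [hNdef, ← normSq_star (a := a), ← map_mul, hs, normSq_def', re_add, imI_add, imJ_add,
      imK_add, ← r₀, ← r₁, ← r₂, ← r₃, normSq_star]
    simp [hNdef]
  have hsq : ∀ {x : ℤ}, 2 * |x| ≤ N → 4 * x ^ 2 ≤ N ^ 2 := by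
    intro x hx
    have := abs_nonneg x
    rw [← sq_abs x]
    nlinarith
  have e₀ := hsq h₀
  have e₁ := hsq h₁
  have e₂ := hsq h₂
  have e₃ := hsq h₃
  have hle : normSq (c + t * a) ≤ N := by
    by_contra hlt
    nlinarith
  rcases hle.lt_or_eq with h | h
  · exact Or.inl h
  · refine Or.inr ⟨?_, h⟩
    rw [h] at hprod
    -- Equality forces every coordinate to be ±N/2, so `N` is even.
    have : Even (N ^ 2) := by
      have h5 : N ^ 2 = 4 * ((c * star a).re + t₀ * N) ^ 2 := by nlinarith
      rw [h5]
      exact ⟨2 * ((c * star a).re + t₀ * N) ^ 2, by ring⟩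
    exact (Int.even_pow.1 this).1

/-- The sum of the coordinates modulo 2. -/
def parity : LipschitzQuaternion →+* ZMod 2 where
  toFun q := q.re + q.imI + q.imJ + q.imK
  map_one' := by simp
  map_zero' := by simp
  map_add' a b := by simp; ring
  map_mul' a b := by
    simp [CharTwo.sub_eq_add]
    ring

/-- Squaring is the identity modulo 2, so the norm and the sum of the coordinates have the same
parity. -/
theorem parity_eq_zero {q : LipschitzQuaternion} (h : Even (normSq q)) : parity q = 0 := by
  have h1 : ((normSq q : ℤ) : ZMod 2) = 0 := (ZMod.intCast_zmod_eq_zero_iff_dvd _ 2).2 h.two_dvd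
  have h2 : ∀ x : ZMod 2, x ^ 2 = x := by decide
  rw [normSq_def'] at h1
  push_cast at h1
  rw [h2, h2, h2, h2] at h1
  exact h1

theorem normSq_coe_unit (u : LipschitzQuaternionˣ) : normSq (u : LipschitzQuaternion) = 1 := by
  have h : IsUnit (normSq (u : LipschitzQuaternion)) := u.isUnit.map normSq
  rcases Int.isUnit_iff.1 h with h | h
  · exact h
  · have := normSq_nonneg (u : LipschitzQuaternion)
    omega

/-- The unit `i`. -/
def unitI : LipschitzQuaternionˣ := ⟨⟨0, 1, 0, 0⟩, ⟨0, -1, 0, 0⟩, rfl, rfl⟩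

/-- The unit `j`. -/
def unitJ : LipschitzQuaternionˣ := ⟨⟨0, 0, 1, 0⟩, ⟨0, 0, -1, 0⟩, rfl, rfl⟩

/-- The unit `k`. -/
def unitK : LipschitzQuaternionˣ := ⟨⟨0, 0, 0, 1⟩, ⟨0, 0, 0, -1⟩, rfl, rfl⟩

theorem exists_unit_eq (u : LipschitzQuaternionˣ) :
    ∃ w ∈ ({1, unitI, unitJ, unitK} : Set LipschitzQuaternionˣ), u = w ∨ u = -w := by
  have h := normSq_coe_unit u
  rw [normSq_def'] at h
  have h0 := sq_nonneg (u : LipschitzQuaternion).re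
  have h1 := sq_nonneg (u : LipschitzQuaternion).imI
  have h2 := sq_nonneg (u : LipschitzQuaternion).imJ
  have h3 := sq_nonneg (u : LipschitzQuaternion).imK
  have hb : ∀ x : ℤ, x ^ 2 ≤ 1 → x = 0 ∨ x = 1 ∨ x = -1 := by
    intro x hx
    have : x ≤ 1 := by nlinarith
    have : -1 ≤ x := by nlinarith
    omega
  rcases hb _ (by linarith : (u : LipschitzQuaternion).re ^ 2 ≤ 1) with e0 | e0 | e0 <;>
  rcases hb _ (by linarith : (u : LipschitzQuaternion).imI ^ 2 ≤ 1) with e1 | e1 | e1 <;>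
  rcases hb _ (by linarith : (u : LipschitzQuaternion).imJ ^ 2 ≤ 1) with e2 | e2 | e2 <;>
  rcases hb _ (by linarith : (u : LipschitzQuaternion).imK ^ 2 ≤ 1) with e3 | e3 | e3 <;>
  first
  | (exfalso; simp [e0, e1, e2, e3] at h; done)
  | exact ⟨1, by simp, Or.inl (Units.ext (Quaternion.ext _ _ e0 e1 e2 e3))⟩
  | exact ⟨1, by simp, Or.inr (Units.ext (Quaternion.ext _ _ e0 e1 e2 e3))⟩
  | exact ⟨unitI, by simp, Or.inl (Units.ext (Quaternion.ext _ _ e0 e1 e2 e3))⟩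
  | exact ⟨unitI, by simp, Or.inr (Units.ext (Quaternion.ext _ _ e0 e1 e2 e3))⟩
  | exact ⟨unitJ, by simp, Or.inl (Units.ext (Quaternion.ext _ _ e0 e1 e2 e3))⟩
  | exact ⟨unitJ, by simp, Or.inr (Units.ext (Quaternion.ext _ _ e0 e1 e2 e3))⟩
  | exact ⟨unitK, by simp, Or.inl (Units.ext (Quaternion.ext _ _ e0 e1 e2 e3))⟩
  | exact ⟨unitK, by simp, Or.inr (Units.ext (Quaternion.ext _ _ e0 e1 e2 e3))⟩

/-- The first column of an invertible matrix can be reduced by elementary matrices. -/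
theorem exists_E2_mul_apply_eq_zero (M : GL2 LipschitzQuaternion) :
    ∃ e ∈ E2 LipschitzQuaternion, (e * M).val 0 0 = 0 := by
  induction hn : (normSq (M.val 0 0)).natAbs using Nat.strong_induction_on generalizing M with
  | _ n ih =>
    subst hn
    by_cases ha : M.val 0 0 = 0
    · exact ⟨1, one_mem _, by simpa using ha⟩
    · obtain ⟨t, ht⟩ := exists_normSq_add_mul_lt _ (M.val 1 0) ha
      have h00 : (matE t * M).val 0 0 = M.val 1 0 + t * M.val 0 0 := by
        rw [Units.val_mul, coe_matE, Matrix.mul_apply, Fin.sum_univ_two]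
        simp [add_comm]
      rcases ht with h | ⟨h, h'⟩
      · obtain ⟨e, he, he'⟩ := ih _ (by
          have := normSq_nonneg (M.val 1 0 + t * M.val 0 0)
          rw [h00]; omega) (matE t * M) rfl
        exact ⟨e * matE t, mul_mem he (matE_mem t), by rwa [mul_assoc]⟩
      -- Both entries of the first column now have even norm, so `parity` kills the column, although
      -- a row of the inverse pairs with it to 1.
      · exfalso
        have p0 := parity_eq_zero h
        have p1 := parity_eq_zero (h' ▸ h)
        rw [map_add, map_mul, p0, mul_zero, add_zero] at p1
        have h1 : (M.inv * M.val) 0 0 = 1 := by rw [M.inv_val]; rfl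
        rw [Matrix.mul_apply, Fin.sum_univ_two] at h1
        have h2 := congrArg parity h1
        rw [map_add, map_mul, map_mul, p0, p1, mul_zero, mul_zero, add_zero, map_one] at h2
        exact zero_ne_one h2

/-- Factors of 1 have norm 1, and then the conjugate is a two-sided inverse. This makes the diagonal
entries of a triangular invertible matrix units. -/
instance : IsDedekindFiniteMonoid LipschitzQuaternion where
  mul_eq_one_symm {a b} h := by
    have h1 : normSq a * normSq b = 1 := by rw [← map_mul, h, map_one]
    have ha : normSq a = 1 := by
      rcases Int.isUnit_iff.1 (IsUnit.of_mul_eq_one _ h1) with h | h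
      · exact h
      · have := normSq_nonneg a
        omega
    have h2 : star a * a = 1 := by rw [star_mul_self, ha]; rfl
    have h3 : b = star a := by
      rw [← one_mul b, ← h2, mul_assoc, h, mul_one]
    rw [h3, h2]

/-- Each invertible matrix over the Lipschitz quaternions is elementary up to a unit. -/
theorem exists_mul_diagGL2_mem_E2 (M : GL2 LipschitzQuaternion) :
    ∃ u : LipschitzQuaternionˣ, M * diagGL2 u 1 ∈ E2 LipschitzQuaternion := by
  obtain ⟨e, he, h0⟩ := exists_E2_mul_apply_eq_zero M
  set N := matE 0 * (e * M) with hN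
  have h10 : N.val 1 0 = 0 := by
    rw [hN, Units.val_mul, coe_matE, Matrix.mul_apply, Fin.sum_univ_two, h0]
    simp
  have h1 : (N.inv * N.val) 0 0 = 1 := by rw [N.inv_val]; rfl
  have h2 : (N.val * N.inv) 1 1 = 1 := by rw [N.val_inv]; rfl
  rw [Matrix.mul_apply, Fin.sum_univ_two, h10] at h1 h2
  rw [mul_zero, add_zero] at h1
  rw [zero_mul, zero_add] at h2
  let u : LipschitzQuaternionˣ := ⟨N.val 0 0, N.inv 0 0, mul_eq_one_symm h1, h1⟩
  let v : LipschitzQuaternionˣ := ⟨N.val 1 1, N.inv 1 1, h2, mul_eq_one_symm h2⟩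
  obtain ⟨w, hw⟩ := exists_mul_diagGL2_mem N u v (N.val 0 1) (by
    refine (Matrix.eta_fin_two N.val).trans ?_
    rw [h10])
  refine ⟨w, ?_⟩
  have h3 : M * diagGL2 w 1 = (matE 0 * e)⁻¹ * (N * diagGL2 w 1) := by
    rw [hN]; group
  rw [h3]
  exact mul_mem (inv_mem (mul_mem (matE_mem _) he)) hw

end LipschitzQuaternion

/-! ### Reduction modulo 2 and the index of the elementary subgroup -/

/-- The ring of Lipschitz quaternions modulo 2. -/
def LipschitzModTwo : Type := Quaternion (ZMod 2)

namespace LipschitzModTwo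

instance : Ring LipschitzModTwo := inferInstanceAs (Ring (Quaternion (ZMod 2)))

/-- The signs in ij = -ji and its analogues disappear in characteristic 2. Commutativity is what
makes a determinant available. -/
instance : CommRing LipschitzModTwo where
  mul_comm a b := by
    apply Quaternion.ext
    · exact (Quaternion.re_mul _ _).trans (Eq.trans (by ring) (Quaternion.re_mul _ _).symm)
    · exact (Quaternion.imI_mul _ _).trans
        (Eq.trans (by rw [CharTwo.sub_eq_add, CharTwo.sub_eq_add]; ring) (Quaternion.imI_mul _ _).symm)
    · exact (Quaternion.imJ_mul _ _).trans
        (Eq.trans (by rw [CharTwo.sub_eq_add, CharTwo.sub_eq_add]; ring) (Quaternion.imJ_mul _ _).symm)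
    · exact (Quaternion.imK_mul _ _).trans
        (Eq.trans (by rw [CharTwo.sub_eq_add, CharTwo.sub_eq_add]; ring) (Quaternion.imK_mul _ _).symm)

end LipschitzModTwo

namespace LipschitzQuaternion

open Quaternion

/-- Reduction modulo 2. -/
def modTwo : LipschitzQuaternion →+* LipschitzModTwo where
  toFun q := (⟨q.re, q.imI, q.imJ, q.imK⟩ : Quaternion (ZMod 2))
  map_one' := Quaternion.ext _ _ Int.cast_one Int.cast_zero Int.cast_zero Int.cast_zero
  map_zero' := Quaternion.ext _ _ Int.cast_zero Int.cast_zero Int.cast_zero Int.cast_zero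
  map_add' a b :=
    Quaternion.ext _ _ (Int.cast_add _ _) (Int.cast_add _ _) (Int.cast_add _ _) (Int.cast_add _ _)
  map_mul' a b := by
    apply Quaternion.ext
    · refine Eq.trans ?_ (Quaternion.re_mul _ _).symm
      simp only [Quaternion.re_mul, Int.cast_sub, Int.cast_mul]
    · refine Eq.trans ?_ (Quaternion.imI_mul _ _).symm
      simp only [Quaternion.imI_mul, Int.cast_add, Int.cast_sub, Int.cast_mul]
    · refine Eq.trans ?_ (Quaternion.imJ_mul _ _).symm
      simp only [Quaternion.imJ_mul, Int.cast_add, Int.cast_sub, Int.cast_mul]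
    · refine Eq.trans ?_ (Quaternion.imK_mul _ _).symm
      simp only [Quaternion.imK_mul, Int.cast_add, Int.cast_sub, Int.cast_mul]

theorem modTwo_eq_iff {a b : LipschitzQuaternion} : modTwo a = modTwo b ↔
    (2 ∣ b.re - a.re ∧ 2 ∣ b.imI - a.imI ∧ 2 ∣ b.imJ - a.imJ ∧ 2 ∣ b.imK - a.imK) := by
  rw [show ((2 : ℤ)) = ((2 : ℕ) : ℤ) from rfl, ← ZMod.intCast_eq_intCast_iff_dvd_sub,
    ← ZMod.intCast_eq_intCast_iff_dvd_sub, ← ZMod.intCast_eq_intCast_iff_dvd_sub,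
    ← ZMod.intCast_eq_intCast_iff_dvd_sub]
  exact Quaternion.ext_iff

theorem modTwo_star (a : LipschitzQuaternion) : modTwo (star a) = modTwo a := by
  rw [modTwo_eq_iff]
  simp only [Quaternion.re_star, Quaternion.imI_star, Quaternion.imJ_star, Quaternion.imK_star]
  omega

/-- The determinant modulo 2 of an invertible matrix. -/
def detModTwo : GL2 LipschitzQuaternion →* LipschitzModTwoˣ :=
  Units.map (Matrix.detMonoidHom.comp
    (modTwo.mapMatrix (m := Fin 2) : _ →* Matrix (Fin 2) (Fin 2) LipschitzModTwo))

theorem coe_detModTwo (M : GL2 LipschitzQuaternion) : (detModTwo M : LipschitzModTwo) =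
    modTwo (M.val 0 0 * M.val 1 1 - M.val 0 1 * M.val 1 0) := by
  change Matrix.det (M.val.map modTwo) = _
  rw [Matrix.det_fin_two, map_sub, map_mul, map_mul]
  rfl

theorem detModTwo_matE (x : LipschitzQuaternion) : detModTwo (matE x) = 1 := by
  apply Units.ext
  rw [coe_detModTwo]
  simp [coe_matE]

theorem E2_le_ker_detModTwo : E2 LipschitzQuaternion ≤ detModTwo.ker := by
  rw [E2, Subgroup.closure_le]
  rintro _ ⟨x, rfl⟩
  exact detModTwo_matE x

theorem detModTwo_diagGL2 (u : LipschitzQuaternionˣ) :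
    detModTwo (diagGL2 u 1) = Units.map (modTwo : _ →* LipschitzModTwo) u := by
  apply Units.ext
  rw [coe_detModTwo]
  simp [coe_diagGL2]

theorem modTwo_unit_neg (u : LipschitzQuaternionˣ) :
    Units.map (modTwo : _ →* LipschitzModTwo) (-u) = Units.map (modTwo : _ →* LipschitzModTwo) u := by
  apply Units.ext
  change modTwo (-u : LipschitzQuaternion) = modTwo u
  rw [modTwo_eq_iff]
  simp only [Quaternion.re_neg, Quaternion.imI_neg, Quaternion.imJ_neg, Quaternion.imK_neg]
  omega

/-- This rests on ijk = -1 together with i⁻¹j⁻¹k⁻¹ = 1. -/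
theorem diagGL2_neg_one_mem : diagGL2 (-1 : LipschitzQuaternionˣ) 1 ∈ E2 LipschitzQuaternion := by
  have h : diagGL2 (-1 : LipschitzQuaternionˣ) 1 =
      diagGL2 unitI unitI⁻¹ * diagGL2 unitJ unitJ⁻¹ * diagGL2 unitK unitK⁻¹ := by
    rw [diagGL2_mul, diagGL2_mul]
    rfl
  rw [h]
  exact mul_mem (mul_mem (diagGL2_inv_mem _) (diagGL2_inv_mem _)) (diagGL2_inv_mem _)

/-- The images modulo 2 of the units `1, i, j, k`. -/
def unitModTwo : Fin 4 → LipschitzModTwoˣ := fun t =>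
  Units.map (modTwo : _ →* LipschitzModTwo) (![1, unitI, unitJ, unitK] t)

theorem unitModTwo_injective : Function.Injective unitModTwo := by
  intro s t h
  have h' := modTwo_eq_iff.1 (Units.ext_iff.1 h : modTwo (_ : LipschitzQuaternionˣ) = modTwo (_ : LipschitzQuaternionˣ))
  revert h'
  fin_cases s <;> fin_cases t <;> first | (intro _; rfl) | decide

/-- Up to an elementary matrix, an element of the kernel is diag(u, 1) with u ≡ 1 modulo 2. This
leaves u = ±1, and both diagonal matrices are elementary. -/
theorem ker_detModTwo : detModTwo.ker = E2 LipschitzQuaternion := by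
  refine le_antisymm (fun M hM => ?_) E2_le_ker_detModTwo
  obtain ⟨u, hu⟩ := exists_mul_diagGL2_mem_E2 M
  have h1 : Units.map (modTwo : _ →* LipschitzModTwo) u = 1 := by
    have := E2_le_ker_detModTwo hu
    rwa [MonoidHom.mem_ker, map_mul, MonoidHom.mem_ker.1 hM, one_mul, detModTwo_diagGL2] at this
  have h2 : u = 1 ∨ u = -1 := by
    obtain ⟨w, hw, h⟩ := exists_unit_eq u
    have h3 : Units.map (modTwo : _ →* LipschitzModTwo) w = 1 := by
      rcases h with rfl | rfl
      · exact h1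
      · rwa [modTwo_unit_neg] at h1
    suffices hw1 : w = 1 by rwa [hw1] at h
    have h0 : unitModTwo 0 = 1 := map_one _
    rcases hw with rfl | rfl | rfl | rfl
    · rfl
    · exact absurd (unitModTwo_injective (a₁ := 1) (a₂ := 0) (h3.trans h0.symm)) (by decide)
    · exact absurd (unitModTwo_injective (a₁ := 2) (a₂ := 0) (h3.trans h0.symm)) (by decide)
    · exact absurd (unitModTwo_injective (a₁ := 3) (a₂ := 0) (h3.trans h0.symm)) (by decide)
  have h3 : diagGL2 u 1 ∈ E2 LipschitzQuaternion := by
    rcases h2 with rfl | rfl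
    · have : diagGL2 (1 : LipschitzQuaternionˣ) 1 = 1 := by
        apply Units.ext
        simp [coe_diagGL2, Matrix.one_fin_two]
      rw [this]
      exact one_mem _
    · exact diagGL2_neg_one_mem
  exact (Subgroup.mul_mem_cancel_right _ h3).1 hu

theorem range_detModTwo : (detModTwo.range : Set LipschitzModTwoˣ) = Set.range unitModTwo := by
  ext x
  constructor
  · rintro ⟨M, rfl⟩
    obtain ⟨u, hu⟩ := exists_mul_diagGL2_mem_E2 M
    have h := E2_le_ker_detModTwo hu
    rw [MonoidHom.mem_ker, map_mul, mul_eq_one_iff_eq_inv, detModTwo_diagGL2, ← map_inv] at h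
    rw [h]
    obtain ⟨w, hw, h'⟩ := exists_unit_eq u⁻¹
    have h'' : Units.map (modTwo : _ →* LipschitzModTwo) u⁻¹ =
        Units.map (modTwo : _ →* LipschitzModTwo) w := by
      rcases h' with h' | h' <;> rw [h']
      exact modTwo_unit_neg w
    rw [h'']
    rcases hw with rfl | rfl | rfl | rfl
    exacts [⟨0, rfl⟩, ⟨1, rfl⟩, ⟨2, rfl⟩, ⟨3, rfl⟩]
  · rintro ⟨t, rfl⟩
    exact ⟨diagGL2 _ 1, detModTwo_diagGL2 _⟩

theorem index_E2 : (E2 LipschitzQuaternion).index = 4 := by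
  rw [← ker_detModTwo, Subgroup.index_ker]
  have h := Nat.card_range_of_injective unitModTwo_injective
  rw [← range_detModTwo, Nat.card_fin] at h
  exact h

/-! ### Reduced norms of the generators; SL₂ is all of GL₂ -/

theorem reducedNorm_eq_det (a : Matrix (Fin 2) (Fin 2) (Quaternion ℚ)) :
    reducedNorm a = (matQuatToComplex a).det := by
  change (splittingHom (1 ⊗ₜ a)).det = _
  rw [splittingHom_tmul, one_smul]

theorem matQuatToComplex_apply (a : Matrix (Fin 2) (Fin 2) (Quaternion ℚ)) (i j k l : Fin 2) :
    matQuatToComplex a (i, k) (j, l) = quatToComplex (a i j) k l := rfl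

theorem reducedNorm_eq_det_fin_four (p q r s : Quaternion ℚ) :
    reducedNorm !![p, q; r, s] = Matrix.det (!![
      p.re + p.imI * Complex.I, p.imJ + p.imK * Complex.I,
        q.re + q.imI * Complex.I, q.imJ + q.imK * Complex.I;
      -p.imJ + p.imK * Complex.I, p.re - p.imI * Complex.I,
        -q.imJ + q.imK * Complex.I, q.re - q.imI * Complex.I;
      r.re + r.imI * Complex.I, r.imJ + r.imK * Complex.I,
        s.re + s.imI * Complex.I, s.imJ + s.imK * Complex.I;
      -r.imJ + r.imK * Complex.I, r.re - r.imI * Complex.I,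
        -s.imJ + s.imK * Complex.I, s.re - s.imI * Complex.I] : Matrix (Fin 4) (Fin 4) ℂ) := by
  rw [reducedNorm_eq_det,
    ← Matrix.det_submatrix_equiv_self (finProdFinEquiv (m := 2) (n := 2)).symm]
  congr 1
  ext i j
  rw [Matrix.submatrix_apply]
  fin_cases i <;> fin_cases j <;>
  · refine (matQuatToComplex_apply _ _ _ _ _).trans ?_
    rw [quatToComplex_apply]
    rfl

theorem reducedNorm_matE (x : Quaternion ℚ) : reducedNorm !![x, 1; -1, 0] = 1 := by
  rw [reducedNorm_eq_det_fin_four, Matrix.det_succ_row_zero]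
  simp [Fin.sum_univ_succ, Matrix.det_fin_three, Fin.succAbove]

theorem reducedNorm_diagonal (x : Quaternion ℚ) :
    reducedNorm !![x, 0; 0, 1] = (Quaternion.normSq x : ℚ) := by
  rw [reducedNorm_eq_det_fin_four, Matrix.det_succ_row_zero]
  simp [Fin.sum_univ_succ, Matrix.det_fin_three, Fin.succAbove, Quaternion.normSq_def']
  ring_nf
  simp

theorem normSq_toRat (q : LipschitzQuaternion) :
    Quaternion.normSq (toRat q) = (Quaternion.normSq q : ℤ) := by
  rw [Quaternion.normSq_def', Quaternion.normSq_def']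
  push_cast
  rfl

theorem E2_le_SL2Lipschitz : E2 LipschitzQuaternion ≤ SL2Lipschitz := by
  rw [E2, Subgroup.closure_le]
  rintro _ ⟨x, rfl⟩
  rw [SetLike.mem_coe, mem_SL2Lipschitz, coe_matE]
  convert reducedNorm_matE (toRat x)
  ext1 i j
  fin_cases i <;> fin_cases j <;> simp

theorem diagGL2_mem_SL2Lipschitz (u : LipschitzQuaternionˣ) : diagGL2 u 1 ∈ SL2Lipschitz := by
  rw [mem_SL2Lipschitz, coe_diagGL2]
  convert reducedNorm_diagonal (toRat u)
  · ext1 i j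
    fin_cases i <;> fin_cases j <;> simp
  · simp [normSq_toRat, normSq_coe_unit]

/-- The group is generated by elementary matrices, of reduced norm 1, and matrices diag(u, 1), whose
reduced norm is N(u) = 1. -/
theorem SL2Lipschitz_eq_top : SL2Lipschitz = ⊤ := by
  refine eq_top_iff.2 fun M _ => ?_
  obtain ⟨u, hu⟩ := exists_mul_diagGL2_mem_E2 M
  exact (Subgroup.mul_mem_cancel_right _ (diagGL2_mem_SL2Lipschitz u)).1 (E2_le_SL2Lipschitz hu)

theorem relIndex_E2 : (E2 LipschitzQuaternion).relIndex SL2Lipschitz = 4 := by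
  rw [SL2Lipschitz_eq_top, Subgroup.relIndex_top_right, index_E2]

end LipschitzQuaternion

/-! ### Quaternionic Hermitian forms and the amalgam decomposition -/

namespace LipschitzQuaternion

open Quaternion

/-- The function defined by the Hermitian form with matrix `(a, q; star q, b)`. -/
def hermEval (a b : ℤ) (q : LipschitzQuaternion) (v : Fin 2 → LipschitzQuaternion) : ℤ :=
  a * normSq (v 0) + b * normSq (v 1) + 2 * (star (v 0) * q * v 1).re

theorem hermEval_add (a b a' b' : ℤ) (q q' : LipschitzQuaternion) :
    hermEval a b q + hermEval a' b' q' = hermEval (a + a') (b + b') (q + q') := by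
  funext v
  simp only [Pi.add_apply, hermEval, mul_add, add_mul, re_add]
  ring

theorem hermEval_neg (a b : ℤ) (q : LipschitzQuaternion) :
    -hermEval a b q = hermEval (-a) (-b) (-q) := by
  funext v
  simp only [Pi.neg_apply, hermEval, mul_neg, neg_mul, re_neg]
  ring

theorem hermEval_sub (a b a' b' : ℤ) (q q' : LipschitzQuaternion) :
    hermEval a b q - hermEval a' b' q' = hermEval (a - a') (b - b') (q - q') := by
  rw [sub_eq_add_neg, hermEval_neg, hermEval_add, ← sub_eq_add_neg, ← sub_eq_add_neg,
    ← sub_eq_add_neg]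

theorem hermEval_neg_vec (a b : ℤ) (q : LipschitzQuaternion) (v : Fin 2 → LipschitzQuaternion) :
    hermEval a b q (-v) = hermEval a b q v := by
  simp [hermEval]

theorem hermEval_nonneg {a b : ℤ} {q : LipschitzQuaternion} (ha : 0 ≤ a) (hb : 0 ≤ b)
    (h : normSq q ≤ a * b) : 0 ≤ hermEval a b q := by
  intro v
  change 0 ≤ a * normSq (v 0) + b * normSq (v 1) + 2 * (star (v 0) * q * v 1).re
  rcases ha.eq_or_lt with rfl | ha
  · have hq : q = 0 := normSq_eq_zero.1 (le_antisymm (by linarith) (normSq_nonneg q))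
    rw [hq]
    have := mul_nonneg hb (normSq_nonneg (v 1))
    simpa using this
  -- Completing the square in the variable `v 0`.
  · have key : a * (a * normSq (v 0) + b * normSq (v 1) + 2 * (star (v 0) * q * v 1).re) =
        normSq ((a : LipschitzQuaternion) * v 0 + q * v 1) + (a * b - normSq q) * normSq (v 1) := by
      simp only [normSq_def', re_mul, imI_mul, imJ_mul, imK_mul, re_add, imI_add, imJ_add,
        imK_add, re_star, imI_star, imJ_star, imK_star, re_intCast, imI_intCast, imJ_intCast, imK_intCast, Int.cast_id]
      ring
    have h1 : 0 ≤ a * (a * normSq (v 0) + b * normSq (v 1) + 2 * (star (v 0) * q * v 1).re) := by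
      rw [key]
      exact add_nonneg (normSq_nonneg _) (mul_nonneg (by linarith) (normSq_nonneg _))
    exact nonneg_of_mul_nonneg_right h1 ha

theorem hermEval_semidefinite {a b : ℤ} {q : LipschitzQuaternion} (h : normSq q ≤ a * b) :
    0 ≤ hermEval a b q ∨ hermEval a b q ≤ 0 := by
  rcases mul_nonneg_iff.1 ((normSq_nonneg q).trans h) with ⟨ha, hb⟩ | ⟨ha, hb⟩
  · exact Or.inl (hermEval_nonneg ha hb h)
  · refine Or.inr (neg_nonneg.1 ?_)
    rw [hermEval_neg]
    exact hermEval_nonneg (by omega) (by omega) (by rw [normSq_neg]; linarith)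

/-- A form with vanishing first diagonal entry is linear in `v 0` once `v 1` is fixed, so a nonzero
q would make it negative somewhere. The factor |b| + 1 in the test vector is large enough to
outweigh b. -/
theorem eq_zero_of_hermEval_nonneg {b : ℤ} {q : LipschitzQuaternion} (h : 0 ≤ hermEval 0 b q) :
    q = 0 := by
  have h1 : 0 ≤ hermEval 0 b q ![-(((|b| + 1 : ℤ) : LipschitzQuaternion) * q), 1] := h _
  have h2 : hermEval 0 b q ![-(((|b| + 1 : ℤ) : LipschitzQuaternion) * q), 1] =
      b - 2 * (|b| + 1) * normSq q := by
    simp only [hermEval, Matrix.cons_val_zero, Matrix.cons_val_one, map_one, normSq_def', re_mul,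
      imI_mul, imJ_mul, imK_mul, re_star, imI_star, imJ_star, imK_star, re_intCast, imI_intCast,
      imJ_intCast, imK_intCast, Int.cast_id, re_neg, imI_neg, imJ_neg, imK_neg, re_one, imI_one,
      imJ_one, imK_one]
    ring
  rw [h2] at h1
  have h3 := le_abs_self b
  have h4 := abs_nonneg b
  have h5 := normSq_nonneg q
  by_contra hq
  have h6 : 1 ≤ normSq q := by
    have := mt normSq_eq_zero.1 hq
    omega
  nlinarith

/-- The forms of discriminant one that are congruent to `(0, k; -k, 0)` modulo 2. They are the
walls of a reflection arrangement of disjoint hyperplanes of hyperbolic 5-space. -/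
def wallForms : Set ((Fin 2 → LipschitzQuaternion) → ℤ) :=
  {f | ∃ a b q, f = hermEval a b q ∧ 2 ∣ a ∧ 2 ∣ b ∧ modTwo q = modTwo unitK ∧
    normSq q - a * b = 1}

theorem wallForms_matE {f : (Fin 2 → LipschitzQuaternion) → ℤ} (hf : f ∈ wallForms)
    (x : LipschitzQuaternion) : (fun v => f ((matE x).val.mulVec v)) ∈ wallForms := by
  obtain ⟨a, b, q, rfl, ⟨a', rfl⟩, ⟨b', rfl⟩, hq, hn⟩ := hf
  -- The coefficients of E(x)* F E(x), where F is the Hermitian matrix of the form. Its corner is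
  -- -star q modulo 2, and this is q modulo 2.
  refine ⟨2 * a' * normSq x - 2 * (star x * q).re + 2 * b', 2 * a',
    (2 * a' : ℤ) * star x - star q, ?_, ?_, Dvd.intro _ rfl, ?_, ?_⟩
  · funext v
    have h0 : (matE x).val.mulVec v 0 = x * v 0 + v 1 := by
      simp [coe_matE, Matrix.mulVec, dotProduct, Fin.sum_univ_two]
    have h1 : (matE x).val.mulVec v 1 = -v 0 := by
      simp [coe_matE, Matrix.mulVec, dotProduct, Fin.sum_univ_two]
    simp only [hermEval, h0, h1, normSq_def', re_mul, imI_mul, imJ_mul, imK_mul, re_add, imI_add,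
      imJ_add, imK_add, re_star, imI_star, imJ_star, imK_star, re_intCast, imI_intCast,
      imJ_intCast, imK_intCast, Int.cast_id, re_sub, imI_sub, imJ_sub, imK_sub, re_neg, imI_neg, imJ_neg,
      imK_neg]
    ring
  · rw [mul_assoc]
    exact dvd_add (dvd_sub (Dvd.intro _ rfl) (Dvd.intro _ rfl)) (Dvd.intro _ rfl)
  · have h2 : modTwo ((2 * a' : ℤ) * star x) = modTwo 0 := by
      have h4 : modTwo ((2 * a' : ℤ) : LipschitzQuaternion) = modTwo 0 := by
        rw [modTwo_eq_iff]
        simp only [re_zero, imI_zero, imJ_zero, imK_zero, re_intCast, imI_intCast, imJ_intCast,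
          imK_intCast, Int.cast_id]
        omega
      rw [map_mul, h4, map_zero, zero_mul]
    have h3 : modTwo (-(unitK : LipschitzQuaternion)) = modTwo unitK :=
      Units.ext_iff.1 (modTwo_unit_neg unitK)
    rw [map_sub, h2, modTwo_star, hq, map_zero, zero_sub, ← map_neg, h3]
  · refine Eq.trans ?_ hn
    simp only [normSq_def', re_mul, imI_mul, imJ_mul, imK_mul, re_star, imI_star, imJ_star,
      imK_star, re_intCast, imI_intCast, imJ_intCast, imK_intCast, Int.cast_id, re_sub, imI_sub, imJ_sub,
      imK_sub]
    ring

theorem wallForms_mulVec {g : GL2 LipschitzQuaternion} (hg : g ∈ E2 LipschitzQuaternion)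
    {f : (Fin 2 → LipschitzQuaternion) → ℤ} (hf : f ∈ wallForms) :
    (fun v => f (g.val.mulVec v)) ∈ wallForms := by
  refine E2_induction (P := fun g => ∀ f ∈ wallForms, (fun v => f (g.val.mulVec v)) ∈ wallForms)
    (fun f hf => by simpa using hf) (fun g x ih f hf => ?_) hg f hf
  simpa only [Matrix.mulVec_mulVec, Units.val_mul] using wallForms_matE (ih f hf) x

/-- The Lorentzian product of the two forms is an odd integer, so the difference or the sum has
discriminant at most 0 and is semidefinite. Geometrically, the two walls do not cross. -/
theorem wallForms_nested {f f' : (Fin 2 → LipschitzQuaternion) → ℤ} (hf : f ∈ wallForms)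
    (hf' : f' ∈ wallForms) : (f ≤ f' ∨ f' ≤ f) ∨ (f ≤ -f' ∨ -f' ≤ f) := by
  obtain ⟨a, b, q, rfl, ⟨a₁, ha₁⟩, ⟨b₁, hb₁⟩, hq, hn⟩ := hf
  obtain ⟨a', b', q', rfl, ⟨a₂, ha₂⟩, ⟨b₂, hb₂⟩, hq', hn'⟩ := hf'
  -- Here q ≡ q' ≡ k modulo 2 makes the scalar product of q and q' odd, and the products ab', a'b of
  -- even numbers are divisible by 4.
  have hodd : ∃ t, 2 * (q.re * q'.re + q.imI * q'.imI + q.imJ * q'.imJ + q.imK * q'.imK) -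
      a * b' - a' * b = 4 * t + 2 := by
    obtain ⟨⟨r₀, e₀⟩, ⟨r₁, e₁⟩, ⟨r₂, e₂⟩, ⟨r₃, e₃⟩⟩ := modTwo_eq_iff.1 hq
    obtain ⟨⟨s₀, d₀⟩, ⟨s₁, d₁⟩, ⟨s₂, d₂⟩, ⟨s₃, d₃⟩⟩ := modTwo_eq_iff.1 hq'
    change 0 - _ = _ at e₀ e₁ e₂ d₀ d₁ d₂
    change 1 - _ = _ at e₃ d₃
    refine ⟨2 * (r₀ * s₀ + r₁ * s₁ + r₂ * s₂ + r₃ * s₃) - r₃ - s₃ - a₁ * b₂ - a₂ * b₁, ?_⟩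
    rw [show q.re = -(2 * r₀) by linarith, show q.imI = -(2 * r₁) by linarith,
      show q.imJ = -(2 * r₂) by linarith, show q.imK = 1 - 2 * r₃ by linarith,
      show q'.re = -(2 * s₀) by linarith, show q'.imI = -(2 * s₁) by linarith,
      show q'.imJ = -(2 * s₂) by linarith, show q'.imK = 1 - 2 * s₃ by linarith,
      ha₁, hb₁, ha₂, hb₂]
    ring
  obtain ⟨t, ht⟩ := hodd
  -- The difference has discriminant 2 - (4t + 2) = -4t, the sum 2 + (4t + 2) = 4(t + 1), and one of
  -- them is not positive.
  rcases le_or_gt 0 t with h | h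
  · left
    have h1 : normSq (q - q') ≤ (a - a') * (b - b') := by
      simp only [normSq_def', re_sub, imI_sub, imJ_sub, imK_sub] at hn hn' ⊢
      nlinarith
    rw [← sub_nonneg (a := hermEval a b q), ← sub_nonpos (b := hermEval a' b' q'), hermEval_sub,
      or_comm]
    exact hermEval_semidefinite h1
  · right
    have h1 : normSq (q + q') ≤ (a + a') * (b + b') := by
      simp only [normSq_def', re_add, imI_add, imJ_add, imK_add] at hn hn' ⊢
      nlinarith
    rw [← sub_nonneg (a := hermEval a b q), ← sub_nonpos (b := -hermEval a' b' q'),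
      sub_neg_eq_add, hermEval_add, or_comm]
    exact hermEval_semidefinite h1

/-- The form with matrix `(0, k; -k, 0)`. -/
def baseForm : (Fin 2 → LipschitzQuaternion) → ℤ := hermEval 0 0 unitK

theorem baseForm_mem : baseForm ∈ wallForms :=
  ⟨0, 0, unitK, rfl, dvd_zero _, dvd_zero _, rfl, rfl⟩

theorem baseForm_apply (v : Fin 2 → LipschitzQuaternion) :
    baseForm v = 2 * (star (v 0) * unitK * v 1).re := by
  rw [baseForm, hermEval, zero_mul, zero_mul, zero_add, zero_add]

theorem baseForm_unit : baseForm ![1, unitK] = -2 := by decide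

theorem baseForm_neg_unit : baseForm ![1, -unitK] = 2 := by decide

theorem not_baseForm_le_neg : ¬ baseForm ≤ -baseForm := fun h => by
  have : baseForm ![1, -unitK] ≤ -baseForm ![1, -unitK] := h _
  rw [baseForm_neg_unit] at this
  omega

theorem not_neg_le_baseForm : ¬ -baseForm ≤ baseForm := fun h => by
  have : -baseForm ![1, unitK] ≤ baseForm ![1, unitK] := h _
  rw [baseForm_unit] at this
  omega

end LipschitzQuaternion

/-! ### The action on forms and the stabilizer of a chamber -/

namespace LipschitzQuaternion

open Quaternion

/-- The elementary group acts on functions of column vectors. -/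
instance vecFunctionSMul : SMul (E2 LipschitzQuaternion) ((Fin 2 → LipschitzQuaternion) → ℤ) where
  smul g f v := f ((g⁻¹ : E2 LipschitzQuaternion).val.val.mulVec v)

/-- The action of the elementary group on functions of column vectors. -/
instance vecFunctionAction :
    MulAction (E2 LipschitzQuaternion) ((Fin 2 → LipschitzQuaternion) → ℤ) where
  one_smul f := by
    funext v
    change f ((1⁻¹ : E2 LipschitzQuaternion).val.val.mulVec v) = f v
    simp
  mul_smul g h f := by
    funext v
    change f (((g * h)⁻¹ : E2 LipschitzQuaternion).val.val.mulVec v) =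
      f ((h⁻¹ : E2 LipschitzQuaternion).val.val.mulVec
        ((g⁻¹ : E2 LipschitzQuaternion).val.val.mulVec v))
    rw [Matrix.mulVec_mulVec, mul_inv_rev]
    rfl

theorem vec_smul_apply (g : E2 LipschitzQuaternion) (f : (Fin 2 → LipschitzQuaternion) → ℤ)
    (v : Fin 2 → LipschitzQuaternion) :
    (g • f) v = f ((g⁻¹ : E2 LipschitzQuaternion).val.val.mulVec v) := rfl

theorem inv_vec_smul_apply (g : E2 LipschitzQuaternion) (f : (Fin 2 → LipschitzQuaternion) → ℤ)
    (v : Fin 2 → LipschitzQuaternion) : (g⁻¹ • f) v = f (g.val.val.mulVec v) := by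
  rw [vec_smul_apply, inv_inv]

theorem vec_smul_mono (g : E2 LipschitzQuaternion) (f f' : (Fin 2 → LipschitzQuaternion) → ℤ)
    (h : f ≤ f') : g • f ≤ g • f' := fun _ => h _

theorem vec_smul_neg (g : E2 LipschitzQuaternion) (f : (Fin 2 → LipschitzQuaternion) → ℤ) :
    g • (-f) = -(g • f) := rfl

theorem vec_smul_lt (g : E2 LipschitzQuaternion) {f f' : (Fin 2 → LipschitzQuaternion) → ℤ}
    (h : f < f') : g • f < g • f' :=
  lt_of_le_of_ne (vec_smul_mono g _ _ h.le) fun e => h.ne (MulAction.injective g e)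

theorem smul_mem_wallForms (g : E2 LipschitzQuaternion) {f : (Fin 2 → LipschitzQuaternion) → ℤ}
    (hf : f ∈ wallForms) : g • f ∈ wallForms :=
  wallForms_mulVec (g⁻¹).2 hf

/-- The walls, oriented towards the chamber that lies on the positive side of `baseForm`. -/
def chamberForms : Set ((Fin 2 → LipschitzQuaternion) → ℤ) :=
  -- In terms of half-spaces, `f` contains one of the two sides of the base wall, with the chamber
  -- inside `f`. The strict inequality keeps out `-baseForm`, which faces away from the chamber.
  {f | f ∈ wallForms ∧ (-baseForm < f ∨ baseForm ≤ f)}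

/-- The stabilizer of the chamber that lies on the positive side of `baseForm`. -/
def chamberStabilizer : Subgroup (E2 LipschitzQuaternion) where
  carrier := {g | ∀ f, g • f ∈ chamberForms ↔ f ∈ chamberForms}
  one_mem' f := by rw [one_smul]
  mul_mem' {g h} hg hh f := by rw [mul_smul, hg, hh]
  inv_mem' {g} hg f := by rw [← hg, smul_inv_smul]

theorem mem_chamberStabilizer {g : E2 LipschitzQuaternion} (h : ∀ f ∈ chamberForms, g • f ∈ chamberForms)
    (h' : ∀ f ∈ chamberForms, g⁻¹ • f ∈ chamberForms) : g ∈ chamberStabilizer :=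
  fun f => ⟨fun hf => by simpa using h' _ hf, h f⟩

theorem smul_mem_chamberForms {g : E2 LipschitzQuaternion} (hg : g • baseForm = baseForm)
    {f : (Fin 2 → LipschitzQuaternion) → ℤ} (hf : f ∈ chamberForms) : g • f ∈ chamberForms := by
  refine ⟨smul_mem_wallForms g hf.1, hf.2.imp (fun h => ?_) fun h => ?_⟩
  · have := vec_smul_lt g h
    rwa [vec_smul_neg, hg] at this
  · have := vec_smul_mono g _ _ h
    rwa [hg] at this

theorem stabilizer_le_chamberStabilizer :
    MulAction.stabilizer (E2 LipschitzQuaternion) baseForm ≤ chamberStabilizer := fun _ hg =>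
  mem_chamberStabilizer (fun _ => smul_mem_chamberForms hg)
    (fun _ => smul_mem_chamberForms (inv_smul_eq_iff.2 (Eq.symm hg)))

/-- The image of `baseForm` is again oriented towards the chamber. If it lies above `baseForm`, then
`g⁻¹` moves `baseForm` down; since that image too is oriented towards the chamber, it must be
`baseForm` itself. -/
theorem chamberStabilizer_smul_baseForm {g : E2 LipschitzQuaternion} (hg : g ∈ chamberStabilizer) :
    g • baseForm = baseForm ∨ -baseForm < g • baseForm := by
  have h0 : baseForm ∈ chamberForms := ⟨baseForm_mem, Or.inr le_rfl⟩
  rcases ((hg _).2 h0).2 with h | h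
  · exact Or.inr h
  · left
    have h1 := vec_smul_mono g⁻¹ _ _ h
    rw [inv_smul_smul] at h1
    rcases ((inv_mem hg _).2 h0).2 with h2 | h2
    · exact absurd (h2.le.trans h1) not_neg_le_baseForm
    · exact (inv_smul_eq_iff.1 (le_antisymm h1 h2)).symm

/-! ### Exchanging the sides of a wall, exchanging adjacent walls, and generation -/

/-- The element `(k, 0; 0, -k)`. -/
def sideSwap : E2 LipschitzQuaternion := ⟨diagGL2 unitK unitK⁻¹, diagGL2_inv_mem unitK⟩

theorem sideSwap_mulVec (v : Fin 2 → LipschitzQuaternion) :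
    sideSwap.val.val.mulVec v = ![unitK * v 0, -(unitK * v 1)] := by
  ext1 i
  fin_cases i
  · simp [sideSwap, coe_diagGL2, Matrix.mulVec, dotProduct, Fin.sum_univ_two]
  · simp only [sideSwap, coe_diagGL2, Matrix.mulVec, dotProduct, Fin.sum_univ_two]
    have : ((unitK⁻¹ : LipschitzQuaternionˣ) : LipschitzQuaternion) = -unitK := rfl
    simp [this]

theorem baseForm_sideSwap (v : Fin 2 → LipschitzQuaternion) :
    baseForm (sideSwap.val.val.mulVec v) = -baseForm v := by
  have h : star (unitK * v 0 : LipschitzQuaternion) * unitK * -(unitK * v 1) =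
      -(star (v 0) * unitK * v 1) := by
    have h1 : star (unitK : LipschitzQuaternion) * unitK = 1 := rfl
    rw [star_mul, mul_neg, ← mul_assoc, mul_assoc (star (v 0)), h1, mul_one]
  rw [sideSwap_mulVec, baseForm_apply, baseForm_apply, Matrix.cons_val_zero, Matrix.cons_val_one,
    Matrix.cons_val_fin_one, h, re_neg, mul_neg]

theorem sideSwap_smul : sideSwap • baseForm = -baseForm := by
  have h : sideSwap⁻¹ • baseForm = -baseForm := by
    funext v
    rw [inv_vec_smul_apply, baseForm_sideSwap]
    rfl
  rw [← neg_eq_iff_eq_neg, ← vec_smul_neg, ← h, smul_inv_smul]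

/-- The element `(k, 0; 0, -k) (1, -k; 0, 1)`. -/
def wallSwap : E2 LipschitzQuaternion :=
  sideSwap * ⟨unipGL2 (-(unitK : LipschitzQuaternion)), unipGL2_mem _⟩

theorem baseForm_unipGL2 (x : LipschitzQuaternion) (v : Fin 2 → LipschitzQuaternion) :
    baseForm ((unipGL2 x).val.mulVec v) = baseForm v + 2 * x.imK * normSq (v 1) := by
  have h0 : (unipGL2 x).val.mulVec v 0 = v 0 + x * v 1 := by
    simp [coe_unipGL2, Matrix.mulVec, dotProduct, Fin.sum_univ_two]
  have h1 : (unipGL2 x).val.mulVec v 1 = v 1 := by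
    simp [coe_unipGL2, Matrix.mulVec, dotProduct, Fin.sum_univ_two]
  have hk : (unitK : LipschitzQuaternion).re = 0 ∧ (unitK : LipschitzQuaternion).imI = 0 ∧
    (unitK : LipschitzQuaternion).imJ = 0 ∧ (unitK : LipschitzQuaternion).imK = 1 :=
    ⟨rfl, rfl, rfl, rfl⟩
  rw [baseForm_apply, baseForm_apply, h0, h1]
  generalize (unitK : LipschitzQuaternion) = k at hk
  obtain ⟨k0, k1, k2, k3⟩ := hk
  simp only [k0, k1, k2, k3, normSq_def', re_mul, imI_mul, imJ_mul, imK_mul, re_add,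
    imI_add, imJ_add, imK_add, re_star, imI_star, imJ_star, imK_star]
  ring

/-- The wall adjacent to the base wall: both pass through the same boundary point at infinity, and
their forms differ, up to sign, by a form 2N(v₁) of rank one. -/
theorem wallSwap_smul : wallSwap⁻¹ • baseForm = -baseForm + hermEval 0 2 0 := by
  funext v
  rw [inv_vec_smul_apply]
  change baseForm ((sideSwap.val.val * (unipGL2 (-(unitK : LipschitzQuaternion))).val).mulVec v) = _
  rw [← Matrix.mulVec_mulVec, baseForm_sideSwap, baseForm_unipGL2]
  have hk : (-unitK : LipschitzQuaternion).imK = -1 := rfl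
  rw [hk]
  simp [hermEval]
  ring

theorem wallSwap_mul_self : (wallSwap * wallSwap).val = diagGL2 (-1) (-1) := by
  change diagGL2 unitK unitK⁻¹ * unipGL2 (-(unitK : LipschitzQuaternion)) *
    (diagGL2 unitK unitK⁻¹ * unipGL2 (-(unitK : LipschitzQuaternion))) = _
  apply Units.ext
  have : ((unitK⁻¹ : LipschitzQuaternionˣ) : LipschitzQuaternion) = -unitK := rfl
  have hk : (unitK : LipschitzQuaternion) * unitK = -1 := rfl
  simp [coe_diagGL2, coe_unipGL2, this, hk]

/-- The square of `wallSwap` is the scalar -1, which acts trivially because Hermitian forms are even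
functions. -/
theorem wallSwap_inv_smul {f : (Fin 2 → LipschitzQuaternion) → ℤ} (hf : f ∈ wallForms) :
    wallSwap • f = wallSwap⁻¹ • f := by
  rw [eq_inv_smul_iff, ← mul_smul, ← eq_inv_smul_iff]
  obtain ⟨a, b, q, rfl, -⟩ := hf
  funext v
  rw [inv_vec_smul_apply, wallSwap_mul_self]
  have : (diagGL2 (-1) (-1) : GL2 LipschitzQuaternion).val.mulVec v = -v := by
    ext1 i
    fin_cases i <;> simp [coe_diagGL2, Matrix.mulVec, dotProduct, Fin.sum_univ_two]
  rw [this, hermEval_neg_vec]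

/-- No wall lies strictly between the two adjacent walls. -/
theorem eq_or_eq_of_between {f : (Fin 2 → LipschitzQuaternion) → ℤ} (hf : f ∈ wallForms)
    (h : baseForm - hermEval 0 2 0 ≤ f) (h' : f ≤ baseForm) :
    f = baseForm - hermEval 0 2 0 ∨ f = baseForm := by
  obtain ⟨a, b, q, rfl, -, ⟨b', rfl⟩, -, -⟩ := hf
  have e1 : baseForm - hermEval 0 2 0 = hermEval 0 (-2) unitK := by
    rw [baseForm, hermEval_sub]; simp
  rw [e1] at h ⊢
  -- Both bounds vanish at (1, 0), so a = 0. Then `baseForm` minus the form is nonnegative with zero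
  -- first diagonal entry, which forces q = k. Finally -2 ≤ b ≤ 0 with b even leaves two values.
  have ha : a = 0 := by
    have h1 := h ![1, 0]
    have h2 := h' ![1, 0]
    simp [hermEval, baseForm] at h1 h2
    omega
  subst ha
  have hq : q = unitK := by
    have h1 := sub_nonneg.2 h'
    rw [baseForm, hermEval_sub, sub_zero] at h1
    exact (sub_eq_zero.1 (eq_zero_of_hermEval_nonneg h1)).symm
  subst hq
  have h1 := h ![0, 1]
  have h2 := h' ![0, 1]
  simp [hermEval, baseForm] at h1 h2
  have : b' = 0 ∨ b' = -1 := by omega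
  rcases this with rfl | rfl
  · exact Or.inr rfl
  · exact Or.inl rfl

theorem wallSwap_smul_baseForm : wallSwap • baseForm = -baseForm + hermEval 0 2 0 := by
  rw [wallSwap_inv_smul baseForm_mem, wallSwap_smul]

theorem not_sub_le_neg_baseForm : ¬ baseForm - hermEval 0 2 0 ≤ -baseForm := fun h => by
  -- At this vector `baseForm` is 4 and the rank one form is 2, so the inequality would read 2 ≤ -4.
  have h := h ![2 * unitK, 1]
  simp only [Pi.sub_apply, Pi.neg_apply, baseForm_apply, hermEval, Matrix.cons_val_zero,
    Matrix.cons_val_one, Matrix.cons_val_fin_one] at h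
  revert h
  decide

/-- The element exchanges two adjacent walls, both oriented towards the chamber. The image of a
half-space is compared with `baseForm` by `wallForms_nested`; the only doubtful case, an image
between the two walls, is settled by `eq_or_eq_of_between`. -/
theorem wallSwap_smul_mem {f : (Fin 2 → LipschitzQuaternion) → ℤ} (hf : f ∈ chamberForms) :
    wallSwap • f ∈ chamberForms := by
  have hpos : (0 : (Fin 2 → LipschitzQuaternion) → ℤ) < hermEval 0 2 0 := by
    refine lt_of_le_of_ne (hermEval_nonneg le_rfl (by norm_num) (by simp)) fun h => ?_
    have := congrFun h ![0, 1]
    simp [hermEval] at this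
  have hadj : -baseForm < wallSwap • baseForm := by
    rw [wallSwap_smul_baseForm]
    exact lt_add_of_pos_right _ hpos
  have hw := smul_mem_wallForms wallSwap hf.1
  refine ⟨hw, ?_⟩
  rcases hf.2 with h | h
  · have h1 := vec_smul_lt wallSwap h
    rw [vec_smul_neg, wallSwap_smul_baseForm, neg_add, neg_neg, ← sub_eq_add_neg] at h1
    have hne : wallSwap • f ≠ -baseForm := by
      intro h2
      exact not_sub_le_neg_baseForm (h2 ▸ h1.le)
    rcases wallForms_nested hw baseForm_mem with (h2 | h2) | (h2 | h2)
    · rcases eq_or_eq_of_between hw h1.le h2 with h3 | h3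
      · exact absurd h3 h1.ne'
      · exact Or.inr h3.ge
    · exact Or.inr h2
    · exact absurd (h1.le.trans h2) not_sub_le_neg_baseForm
    · exact Or.inl (lt_of_le_of_ne h2 hne.symm)
  · exact Or.inl (hadj.trans_le (vec_smul_mono wallSwap _ _ h))

theorem wallSwap_mem : wallSwap ∈ chamberStabilizer :=
  mem_chamberStabilizer (fun _ => wallSwap_smul_mem) fun f hf => by
    rw [← wallSwap_inv_smul hf.1]
    exact wallSwap_smul_mem hf

theorem unipGL2_add (x y : LipschitzQuaternion) :
    unipGL2 (x + y) = unipGL2 x * unipGL2 y := by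
  apply Units.ext
  simp [coe_unipGL2, add_comm]

/-- E(0) and the translations by x without k-coordinate fix `baseForm`, so they stabilize the
chamber. The missing translation by -k is `sideSwap⁻¹ * wallSwap`. Together these give all
translations, hence all E(x). -/
theorem closure_sideSwap_chamberStabilizer :
    Subgroup.closure (insert sideSwap (chamberStabilizer : Set (E2 LipschitzQuaternion))) = ⊤ := by
  set K := Subgroup.closure (insert sideSwap (chamberStabilizer : Set (E2 LipschitzQuaternion)))
  let K' := K.map (E2 LipschitzQuaternion).subtype
  have hstab : ∀ g (hg : g ∈ E2 LipschitzQuaternion),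
      (∀ v, baseForm (g.val.mulVec v) = baseForm v) → g ∈ K' := by
    intro g hg h
    refine ⟨⟨g, hg⟩, Subgroup.subset_closure (Or.inr (stabilizer_le_chamberStabilizer ?_)), rfl⟩
    rw [MulAction.mem_stabilizer_iff, ← eq_inv_smul_iff]
    funext v
    rw [inv_vec_smul_apply, h]
  have hE0 : matE 0 ∈ K' := by
    refine hstab _ (matE_mem 0) fun v => ?_
    have h0 : (matE (0 : LipschitzQuaternion)).val.mulVec v 0 = v 1 := by
      simp [coe_matE, Matrix.mulVec, dotProduct, Fin.sum_univ_two]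
    have h1 : (matE (0 : LipschitzQuaternion)).val.mulVec v 1 = -v 0 := by
      simp [coe_matE, Matrix.mulVec, dotProduct, Fin.sum_univ_two]
    rw [baseForm_apply, baseForm_apply, h0, h1, ← re_star (star (v 1) * (unitK : LipschitzQuaternion) * -v 0)]
    have hk : star (unitK : LipschitzQuaternion) = -unitK := rfl
    simp only [star_mul, star_neg, star_star, hk, neg_mul, mul_neg, neg_neg, mul_assoc]
  have hk : unipGL2 (-(unitK : LipschitzQuaternion)) ∈ K' := by
    refine ⟨sideSwap⁻¹ * wallSwap, mul_mem (inv_mem (Subgroup.subset_closure (Or.inl rfl)))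
      (Subgroup.subset_closure (Or.inr wallSwap_mem)), ?_⟩
    rw [wallSwap, inv_mul_cancel_left]
    rfl
  let A : AddSubgroup LipschitzQuaternion :=
    { carrier := {x | unipGL2 x ∈ K'}
      zero_mem' := hstab _ (unipGL2_mem 0) fun v => by rw [baseForm_unipGL2]; simp
      add_mem' := fun {x y} hx hy => by
        rw [Set.mem_ofPred_eq, unipGL2_add]
        exact mul_mem hx hy
      neg_mem' := fun {x} hx => by
        have h : unipGL2 x * unipGL2 (-x) = 1 := by
          rw [← unipGL2_add, add_neg_cancel]
          apply Units.ext
          simp [coe_unipGL2, Matrix.one_fin_two]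
        rw [Set.mem_ofPred_eq, eq_inv_of_mul_eq_one_right h]
        exact inv_mem hx }
  have hunip : ∀ x, unipGL2 x ∈ K' := by
    intro x
    have h1 : x + x.imK • -(unitK : LipschitzQuaternion) ∈ A := by
      refine hstab _ (unipGL2_mem _) fun v => ?_
      have : (x + x.imK • -(unitK : LipschitzQuaternion)).imK = 0 := by
        have hk : (unitK : LipschitzQuaternion).imK = 1 := rfl
        rw [imK_add, imK_smul, imK_neg, hk]
        simp
      rw [baseForm_unipGL2, this]
      simp
    exact (AddSubgroup.add_mem_cancel_right A (zsmul_mem (K := A) hk x.imK)).1 h1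
  have hE : ∀ x, matE x ∈ K' := by
    intro x
    have h := matE_mul_matE_zero x
    rw [← matE_zero_mul_self, ← eq_mul_inv_iff_mul_eq] at h
    rw [h]
    exact mul_mem (mul_mem (mul_mem hE0 hE0) (hunip _)) (inv_mem hE0)
  rw [eq_top_iff]
  rintro ⟨g, hg⟩ -
  obtain ⟨h, hh, e⟩ : g ∈ K' := E2_induction (P := (· ∈ K')) (one_mem _)
    (fun g x hg => mul_mem hg (hE x)) hg
  rwa [← show h = ⟨g, hg⟩ from Subtype.ext e]

theorem isNontrivialAmalgam_E2 : IsNontrivialAmalgam (E2 LipschitzQuaternion) :=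
  isNontrivialAmalgam_of_action vec_smul_mono (fun _ _ => neg_le_neg) vec_smul_neg baseForm
    not_baseForm_le_neg sideSwap sideSwap_smul chamberStabilizer
    (fun _ => chamberStabilizer_smul_baseForm) stabilizer_le_chamberStabilizer
    ⟨wallSwap, wallSwap_mem, fun h => by
      rw [wallSwap_smul_baseForm] at h
      have := congrFun h ![0, 1]
      simp [hermEval, baseForm] at this⟩
    closure_sideSwap_chamberStabilizer

end LipschitzQuaternion

/-! ### The Clifford algebra with three generators -/

noncomputable section CliffFour

set_option linter.unusedSimpArgs false

open Quaternion

/-- The purely imaginary quaternion with given coordinates. -/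
def imVec : (Fin (4 - 1) → ℝ) →ₗ[ℝ] ℍ[ℝ] where
  toFun v := ⟨0, v 0, v 1, v 2⟩
  map_add' _ _ := Quaternion.ext _ _ (add_zero _).symm rfl rfl rfl
  map_smul' _ _ := Quaternion.ext _ _ (mul_zero _).symm rfl rfl rfl

theorem re_imVec (v : Fin (4 - 1) → ℝ) : (imVec v).re = 0 := rfl

theorem imI_imVec (v : Fin (4 - 1) → ℝ) : (imVec v).imI = v 0 := rfl

theorem imJ_imVec (v : Fin (4 - 1) → ℝ) : (imVec v).imJ = v 1 := rfl

theorem imK_imVec (v : Fin (4 - 1) → ℝ) : (imVec v).imK = v 2 := rfl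

theorem star_imVec (v : Fin (4 - 1) → ℝ) : star (imVec v) = -imVec v := by
  rw [star_eq_two_re_sub, re_imVec]
  simp

theorem imVec_single :
    ((imVec (Pi.single 0 1)).re = 0 ∧ (imVec (Pi.single 0 1)).imI = 1 ∧
      (imVec (Pi.single 0 1)).imJ = 0 ∧ (imVec (Pi.single 0 1)).imK = 0) ∧
    ((imVec (Pi.single 1 1)).re = 0 ∧ (imVec (Pi.single 1 1)).imI = 0 ∧
      (imVec (Pi.single 1 1)).imJ = 1 ∧ (imVec (Pi.single 1 1)).imK = 0) ∧
    ((imVec (Pi.single 2 1)).re = 0 ∧ (imVec (Pi.single 2 1)).imI = 0 ∧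
      (imVec (Pi.single 2 1)).imJ = 0 ∧ (imVec (Pi.single 2 1)).imK = 1) := by
  refine ⟨⟨rfl, ?_, ?_, ?_⟩, ⟨rfl, ?_, ?_, ?_⟩, rfl, ?_, ?_, ?_⟩ <;>
    first | rw [imI_imVec] | rw [imJ_imVec] | rw [imK_imVec]
  all_goals simp [Pi.single_apply]

theorem Quaternion.mul_self_of_re_eq_zero {R : Type*} [CommRing R] {q : ℍ[R]} (h : q.re = 0) :
    q * q = ((-normSq q : R) : ℍ[R]) := by
  rw [coe_neg, ← self_mul_star, star_eq_two_re_sub, h]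
  simp

theorem imVec_mul_self (v : Fin (4 - 1) → ℝ) :
    imVec v * imVec v = algebraMap ℝ ℍ[ℝ]
      (QuadraticMap.weightedSumSquares ℝ (fun _ : Fin (4 - 1) => (-1 : ℝ)) v) := by
  rw [mul_self_of_re_eq_zero (re_imVec v), normSq_def', QuadraticMap.weightedSumSquares_apply]
  change _ = ((∑ i : Fin 3, (-1 : ℝ) • (v i * v i) : ℝ) : ℍ[ℝ])
  rw [Fin.sum_univ_three, re_imVec, imI_imVec, imJ_imVec, imK_imVec]
  congr 1
  simp only [smul_eq_mul]
  ring

/-- The linear map that sends the generators of the Clifford algebra to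
`(i, -i)`, `(j, -j)` and `(k, -k)`. -/
def cliffFourGenMap : (Fin (4 - 1) → ℝ) →ₗ[ℝ] ℍ[ℝ] × ℍ[ℝ] := imVec.prod (-imVec)

theorem cliffFourGenMap_mul_self (v : Fin (4 - 1) → ℝ) :
    cliffFourGenMap v * cliffFourGenMap v = algebraMap ℝ (ℍ[ℝ] × ℍ[ℝ])
      (QuadraticMap.weightedSumSquares ℝ (fun _ : Fin (4 - 1) => (-1 : ℝ)) v) := by
  change (imVec v * imVec v, -imVec v * -imVec v) = _
  rw [neg_mul_neg, imVec_mul_self]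
  rfl

/-- The homomorphism from the Clifford algebra to the product of two quaternion algebras. -/
def cliffFourHom : Cliff 4 →ₐ[ℝ] ℍ[ℝ] × ℍ[ℝ] :=
  CliffordAlgebra.lift _ ⟨cliffFourGenMap, cliffFourGenMap_mul_self⟩

theorem cliffFourHom_ι (v : Fin (4 - 1) → ℝ) :
    cliffFourHom (CliffordAlgebra.ι _ v) = cliffFourGenMap v :=
  CliffordAlgebra.lift_ι_apply _ _ _

theorem cliffFourHom_gen (h : Fin (4 - 1)) : cliffFourHom (cliffGen 4 h) =
    (imVec (Pi.single h 1), -imVec (Pi.single h 1)) :=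
  cliffFourHom_ι _

theorem cliffGen_mul_self (h : Fin (4 - 1)) : cliffGen 4 h * cliffGen 4 h = -1 := by
  rw [cliffGen, CliffordAlgebra.ι_sq_scalar, QuadraticMap.weightedSumSquares_apply,
    Finset.sum_eq_single h (fun b _ hb => by simp [hb]) (by simp)]
  simp

theorem cliffGen_mul_comm {h k : Fin (4 - 1)} (hk : h ≠ k) :
    cliffGen 4 h * cliffGen 4 k = -(cliffGen 4 k * cliffGen 4 h) := by
  rw [eq_neg_iff_add_eq_zero, cliffGen, cliffGen, CliffordAlgebra.ι_mul_ι_add_swap,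
    QuadraticMap.polar]
  simp only [QuadraticMap.weightedSumSquares_apply]
  rw [← Finset.sum_sub_distrib, ← Finset.sum_sub_distrib, Finset.sum_eq_zero, map_zero]
  intro i _
  by_cases h1 : i = h <;> by_cases h2 : i = k
  · exact absurd (h1.symm.trans h2) hk
  all_goals simp [h1, h2, Pi.single_apply, hk, hk.symm]

/-- The product of the three generators. -/
def cliffOmega : Cliff 4 := cliffGen 4 0 * cliffGen 4 1 * cliffGen 4 2

/-- A rewriting system that sorts words in the generators. The versions with a trailing factor `x`
apply inside products associated to the right. -/
theorem cliffGen_rules :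
    (cliffGen 4 0 * cliffGen 4 0 = -1 ∧ cliffGen 4 1 * cliffGen 4 1 = -1 ∧
      cliffGen 4 2 * cliffGen 4 2 = -1) ∧
    (cliffGen 4 1 * cliffGen 4 0 = -(cliffGen 4 0 * cliffGen 4 1) ∧
      cliffGen 4 2 * cliffGen 4 0 = -(cliffGen 4 0 * cliffGen 4 2) ∧
      cliffGen 4 2 * cliffGen 4 1 = -(cliffGen 4 1 * cliffGen 4 2)) ∧
    (∀ x, cliffGen 4 0 * (cliffGen 4 0 * x) = -x) ∧
    (∀ x, cliffGen 4 1 * (cliffGen 4 1 * x) = -x) ∧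
    (∀ x, cliffGen 4 2 * (cliffGen 4 2 * x) = -x) ∧
    (∀ x, cliffGen 4 1 * (cliffGen 4 0 * x) = -(cliffGen 4 0 * (cliffGen 4 1 * x))) ∧
    (∀ x, cliffGen 4 2 * (cliffGen 4 0 * x) = -(cliffGen 4 0 * (cliffGen 4 2 * x))) ∧
    (∀ x, cliffGen 4 2 * (cliffGen 4 1 * x) = -(cliffGen 4 1 * (cliffGen 4 2 * x))) := by
  have h10 := cliffGen_mul_comm (show (1 : Fin (4 - 1)) ≠ 0 by decide)
  have h20 := cliffGen_mul_comm (show (2 : Fin (4 - 1)) ≠ 0 by decide)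
  have h21 := cliffGen_mul_comm (show (2 : Fin (4 - 1)) ≠ 1 by decide)
  refine ⟨⟨cliffGen_mul_self 0, cliffGen_mul_self 1, cliffGen_mul_self 2⟩, ⟨h10, h20, h21⟩,
    ?_, ?_, ?_, ?_, ?_, ?_⟩ <;> intro x <;> rw [← mul_assoc]
  · rw [cliffGen_mul_self, neg_one_mul]
  · rw [cliffGen_mul_self, neg_one_mul]
  · rw [cliffGen_mul_self, neg_one_mul]
  · rw [h10, neg_mul, mul_assoc]
  · rw [h20, neg_mul, mul_assoc]
  · rw [h21, neg_mul, mul_assoc]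

theorem cliffOmega_mul_self : cliffOmega * cliffOmega = 1 := by
  obtain ⟨⟨a, b, c⟩, ⟨d, e, f⟩, g, h, i, j, k, l⟩ := cliffGen_rules
  simp only [cliffOmega, mul_assoc, a, b, c, d, e, f, g, h, i, j, k, l, mul_neg, neg_neg, mul_one]

/-- A generator commutes with itself and anticommutes with the two other factors, so the two signs
cancel. -/
theorem cliffOmega_comm (x : Cliff 4) : cliffOmega * x = x * cliffOmega := by
  have hgen : ∀ h, cliffOmega * cliffGen 4 h = cliffGen 4 h * cliffOmega := by
    obtain ⟨⟨a, b, c⟩, ⟨d, e, f⟩, g, h, i, j, k, l⟩ := cliffGen_rules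
    intro t
    obtain rfl | rfl | rfl : t = 0 ∨ t = 1 ∨ t = 2 := by
      revert t; decide
    all_goals
      simp only [cliffOmega, mul_assoc, a, b, c, d, e, f, g, h, i, j, k, l, mul_neg, neg_neg,
        mul_one]
  induction x using CliffordAlgebra.induction with
  | algebraMap r => exact Algebra.commutes' _ _ |>.symm
  | ι v =>
    have : v = ∑ h, v h • Pi.single h (1 : ℝ) := (pi_eq_sum_univ' v).trans (by
      refine Finset.sum_congr rfl fun h _ => ?_
      congr 1)
    rw [this, map_sum, Finset.mul_sum, Finset.sum_mul]
    refine Finset.sum_congr rfl fun h _ => ?_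
    rw [map_smul, mul_smul_comm, smul_mul_assoc]
    congr 1
    exact hgen h
  | mul a b ha hb => rw [← mul_assoc, ha, mul_assoc, hb, mul_assoc]
  | add a b ha hb => rw [mul_add, ha, hb, add_mul]

/-- The even elements `i₂ i₃`, `i₃ i₁`, `i₁ i₂` satisfy the relations of the quaternions. -/
def cliffFourEvenBasis : QuaternionAlgebra.Basis (Cliff 4) (-1 : ℝ) 0 (-1) where
  i := cliffGen 4 1 * cliffGen 4 2
  j := -(cliffGen 4 0 * cliffGen 4 2)
  k := cliffGen 4 0 * cliffGen 4 1
  i_mul_i := by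
    obtain ⟨⟨a, b, c⟩, ⟨d, e, f⟩, g, h, i, j, k, l⟩ := cliffGen_rules
    simp [mul_assoc, a, b, c, d, e, f, g, h, i, j, k, l]
  j_mul_j := by
    obtain ⟨⟨a, b, c⟩, ⟨d, e, f⟩, g, h, i, j, k, l⟩ := cliffGen_rules
    simp [mul_assoc, a, b, c, d, e, f, g, h, i, j, k, l]
  i_mul_j := by
    obtain ⟨⟨a, b, c⟩, ⟨d, e, f⟩, g, h, i, j, k, l⟩ := cliffGen_rules
    simp [mul_assoc, a, b, c, d, e, f, g, h, i, j, k, l]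
  j_mul_i := by
    obtain ⟨⟨a, b, c⟩, ⟨d, e, f⟩, g, h, i, j, k, l⟩ := cliffGen_rules
    simp [mul_assoc, a, b, c, d, e, f, g, h, i, j, k, l]

/-- The embedding of the quaternions as the even subalgebra. -/
def cliffFourEven : ℍ[ℝ] →ₐ[ℝ] Cliff 4 := cliffFourEvenBasis.liftHom

theorem cliffFourEven_apply (q : ℍ[ℝ]) : cliffFourEven q = algebraMap ℝ _ q.re +
    q.imI • (cliffGen 4 1 * cliffGen 4 2) + q.imJ • -(cliffGen 4 0 * cliffGen 4 2) +
      q.imK • (cliffGen 4 0 * cliffGen 4 1) := rfl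

/-- The inverse of `cliffFourHom`. -/
def cliffFourInv : ℍ[ℝ] × ℍ[ℝ] →ₐ[ℝ] Cliff 4 :=
  AlgHom.ofLinearMap
    -- The even part is the diagonal of ℍ × ℍ and `cliffOmega` corresponds to (-1, 1), so half the
    -- sum and half the difference x₂ - x₁ are the two even components.
    { toFun := fun x => cliffFourEven ((1 / 2 : ℝ) • (x.1 + x.2)) +
        cliffOmega * cliffFourEven ((1 / 2 : ℝ) • (x.2 - x.1))
      map_add' := fun x y => by
        simp only [Prod.fst_add, Prod.snd_add, map_smul, map_add, map_sub, mul_add, mul_sub,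
          smul_add, smul_sub, mul_smul_comm]
        abel
      map_smul' := fun r x => by
        simp only [Prod.smul_fst, Prod.smul_snd, map_smul, map_add, map_sub, mul_add, mul_sub,
          smul_add, smul_sub, mul_smul_comm, RingHom.id_apply]
        simp only [smul_comm r (1 / 2 : ℝ)] }
    (by
      change cliffFourEven ((1 / 2 : ℝ) • (1 + 1)) +
        cliffOmega * cliffFourEven ((1 / 2 : ℝ) • (1 - 1)) = 1
      rw [← two_smul ℝ (1 : ℍ[ℝ]), smul_smul, sub_self, smul_zero, map_zero, mul_zero, add_zero,
        one_div_mul_cancel two_ne_zero, one_smul, map_one])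
    (fun x y => by
      -- Since `cliffOmega` is central with square 1, the product is that of the group ring of a
      -- group of order 2.
      have h : ∀ a b c d : Cliff 4, (a + cliffOmega * b) * (c + cliffOmega * d) =
          (a * c + b * d) + cliffOmega * (a * d + b * c) := by
        intro a b c d
        have h1 : a * (cliffOmega * d) = cliffOmega * (a * d) := by
          rw [← mul_assoc, ← cliffOmega_comm, mul_assoc]
        have h2 : cliffOmega * b * (cliffOmega * d) = b * d := by
          rw [mul_assoc, ← mul_assoc b, ← cliffOmega_comm b, ← mul_assoc, ← mul_assoc,
            cliffOmega_mul_self, one_mul]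
        rw [add_mul, mul_add, mul_add, h1, h2, mul_add, mul_assoc]
        abel
      change cliffFourEven _ + cliffOmega * cliffFourEven _ =
        (cliffFourEven _ + cliffOmega * cliffFourEven _) *
          (cliffFourEven _ + cliffOmega * cliffFourEven _)
      rw [h]
      simp only [← map_mul, ← map_add]
      congr 3
      · simp only [Prod.fst_mul, Prod.snd_mul]
        have h3 : (x.1 + x.2) * (y.1 + y.2) + (x.2 - x.1) * (y.2 - y.1) =
            (2 : ℝ) • (x.1 * y.1 + x.2 * y.2) := by
          rw [two_smul]; noncomm_ring
        rw [smul_mul_smul_comm, smul_mul_smul_comm, ← smul_add, h3, smul_smul]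
        norm_num
      · simp only [Prod.fst_mul, Prod.snd_mul]
        have h3 : (x.1 + x.2) * (y.2 - y.1) + (x.2 - x.1) * (y.1 + y.2) =
            (2 : ℝ) • (x.2 * y.2 - x.1 * y.1) := by
          rw [two_smul]; noncomm_ring
        rw [smul_mul_smul_comm, smul_mul_smul_comm, ← smul_add, h3, smul_smul]
        norm_num)

theorem cliffFourInv_apply (x : ℍ[ℝ] × ℍ[ℝ]) : cliffFourInv x =
    cliffFourEven ((1 / 2 : ℝ) • (x.1 + x.2)) +
      cliffOmega * cliffFourEven ((1 / 2 : ℝ) • (x.2 - x.1)) := rfl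

theorem cliffFourInv_comp : cliffFourInv.comp cliffFourHom = AlgHom.id ℝ (Cliff 4) := by
  apply CliffordAlgebra.hom_ext
  apply LinearMap.pi_ext'
  intro t
  ext
  simp only [LinearMap.comp_apply, LinearMap.single_apply, AlgHom.toLinearMap_apply,
    AlgHom.comp_apply, AlgHom.id_apply]
  change cliffFourInv (cliffFourHom (cliffGen 4 t)) = cliffGen 4 t
  rw [cliffFourHom_gen, cliffFourInv_apply]
  have h1 : ∀ p : ℍ[ℝ], (1 / 2 : ℝ) • (-p - p) = -p := by
    intro p
    rw [← neg_add', ← two_smul ℝ, smul_neg, smul_smul]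
    norm_num
  rw [h1, add_neg_cancel, smul_zero, map_zero, zero_add, map_neg, cliffFourEven_apply, re_imVec,
    imI_imVec, imJ_imVec, imK_imVec]
  obtain ⟨⟨a, b, c⟩, ⟨d, e, f⟩, g, h, i, j, k, l⟩ := cliffGen_rules
  obtain rfl | rfl | rfl : t = 0 ∨ t = 1 ∨ t = 2 := by
    revert t; decide
  all_goals
    simp [cliffOmega, mul_assoc, a, b, c, d, e, f, g, h, i, j, k, l]

theorem cliffFourHom_even (q : ℍ[ℝ]) : cliffFourHom (cliffFourEven q) = (q, q) := by
  rw [cliffFourEven_apply]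
  simp only [map_add, map_smul, map_mul, map_neg, cliffFourHom_gen, AlgHom.commutes]
  obtain ⟨⟨a0, a1, a2, a3⟩, ⟨b0, b1, b2, b3⟩, c0, c1, c2, c3⟩ := imVec_single
  generalize imVec (Pi.single 0 1) = a at a0 a1 a2 a3 ⊢
  generalize imVec (Pi.single 1 1) = b at b0 b1 b2 b3 ⊢
  generalize imVec (Pi.single 2 1) = c at c0 c1 c2 c3 ⊢
  apply Prod.ext <;> ext <;>
    simp [Prod.algebraMap_apply, a0, a1, a2, a3, b0, b1, b2, b3, c0, c1, c2, c3]

theorem cliffFourHom_omega : cliffFourHom cliffOmega = (-1, 1) := by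
  simp only [cliffOmega, map_mul, cliffFourHom_gen]
  obtain ⟨⟨a0, a1, a2, a3⟩, ⟨b0, b1, b2, b3⟩, c0, c1, c2, c3⟩ := imVec_single
  generalize imVec (Pi.single 0 1) = a at a0 a1 a2 a3 ⊢
  generalize imVec (Pi.single 1 1) = b at b0 b1 b2 b3 ⊢
  generalize imVec (Pi.single 2 1) = c at c0 c1 c2 c3 ⊢
  apply Prod.ext <;> ext <;>
    simp [a0, a1, a2, a3, b0, b1, b2, b3, c0, c1, c2, c3]

theorem cliffFourHom_comp : cliffFourHom.comp cliffFourInv = AlgHom.id ℝ (ℍ[ℝ] × ℍ[ℝ]) := by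
  apply AlgHom.ext
  intro x
  rw [AlgHom.comp_apply, cliffFourInv_apply, map_add, map_mul, cliffFourHom_even,
    cliffFourHom_even, cliffFourHom_omega, AlgHom.id_apply]
  apply Prod.ext
  · simp only [Prod.fst_add, Prod.fst_mul, neg_one_mul, ← sub_eq_add_neg, ← smul_sub]
    rw [show x.1 + x.2 - (x.2 - x.1) = (2 : ℝ) • x.1 by rw [two_smul]; abel, smul_smul]
    norm_num
  · simp only [Prod.snd_add, Prod.snd_mul, one_mul, ← smul_add]
    rw [show x.1 + x.2 + (x.2 - x.1) = (2 : ℝ) • x.2 by rw [two_smul]; abel, smul_smul]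
    norm_num

/-- The Clifford algebra with three generators is the product of two quaternion algebras. -/
def cliffFourEquiv : Cliff 4 ≃ₐ[ℝ] ℍ[ℝ] × ℍ[ℝ] :=
  AlgEquiv.ofAlgHom cliffFourHom cliffFourInv cliffFourHom_comp cliffFourInv_comp

theorem cliffFourEquiv_gen (h : Fin (4 - 1)) : cliffFourEquiv (cliffGen 4 h) =
    (imVec (Pi.single h 1), -imVec (Pi.single h 1)) := cliffFourHom_gen h

/-- Both sides are anti-homomorphisms, and on a generating vector (v, -v) conjugation and the
exchange of components cancel. -/
theorem cliffFourEquiv_reverse (x : Cliff 4) : cliffFourEquiv (CliffordAlgebra.reverse x) =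
    (star (cliffFourEquiv x).2, star (cliffFourEquiv x).1) := by
  induction x using CliffordAlgebra.induction with
  | algebraMap r =>
    rw [CliffordAlgebra.reverse.commutes, AlgEquiv.commutes]
    apply Prod.ext <;> ext <;> simp [Prod.algebraMap_apply]
  | ι v =>
    have h : cliffFourEquiv (CliffordAlgebra.ι _ v) = (imVec v, -imVec v) := cliffFourHom_ι v
    rw [CliffordAlgebra.reverse_ι, h, star_neg, star_imVec, neg_neg]
  | mul a b ha hb =>
    rw [CliffordAlgebra.reverse.map_mul, map_mul, map_mul, ha, hb, Prod.fst_mul, Prod.snd_mul,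
      star_mul, star_mul]
    rfl
  | add a b ha hb =>
    rw [map_add, map_add, map_add, ha, hb, Prod.fst_add, Prod.snd_add, star_add, star_add]
    rfl

end CliffFour

/-! ### Vectors and integral elements as pairs of quaternions -/

noncomputable section CliffFourSubsets

open Quaternion

set_option linter.unusedSimpArgs false

/-- The vector in the Clifford algebra with the coordinates of a given quaternion. -/
def cliffVecOf (p : ℍ[ℝ]) : Cliff 4 := p.re • 1 + p.imI • cliffGen 4 0 + p.imJ • cliffGen 4 1 +
  p.imK • cliffGen 4 2

theorem cliffFourEquiv_vecOf (p : ℍ[ℝ]) : cliffFourEquiv (cliffVecOf p) = (p, star p) := by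
  simp only [cliffVecOf, map_add, map_smul, map_one, cliffFourEquiv_gen]
  obtain ⟨⟨a0, a1, a2, a3⟩, ⟨b0, b1, b2, b3⟩, c0, c1, c2, c3⟩ := imVec_single
  generalize imVec (Pi.single 0 1) = a at a0 a1 a2 a3 ⊢
  generalize imVec (Pi.single 1 1) = b at b0 b1 b2 b3 ⊢
  generalize imVec (Pi.single 2 1) = c at c0 c1 c2 c3 ⊢
  apply Prod.ext <;> ext <;>
    simp [a0, a1, a2, a3, b0, b1, b2, b3, c0, c1, c2, c3]

theorem cliffVecOf_mem (p : ℍ[ℝ]) : cliffVecOf p ∈ cliffVec 4 := by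
  have h1 : (1 : Cliff 4) ∈ cliffVec 4 := Submodule.subset_span (Set.mem_insert _ _)
  have h2 : ∀ h, cliffGen 4 h ∈ cliffVec 4 := fun h =>
    Submodule.subset_span (Set.mem_insert_of_mem _ ⟨h, rfl⟩)
  exact add_mem (add_mem (add_mem (Submodule.smul_mem _ _ h1) (Submodule.smul_mem _ _ (h2 0)))
    (Submodule.smul_mem _ _ (h2 1))) (Submodule.smul_mem _ _ (h2 2))

theorem mem_cliffVec_four (x : Cliff 4) :
    x ∈ cliffVec 4 ↔ (cliffFourEquiv x).2 = star (cliffFourEquiv x).1 := by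
  constructor
  · intro h
    induction h using Submodule.span_induction with
    | mem x hx =>
      rcases hx with rfl | ⟨h, rfl⟩
      · rw [map_one, Prod.snd_one, Prod.fst_one, star_one]
      · rw [cliffFourEquiv_gen, star_imVec]
    | zero => rw [map_zero, Prod.snd_zero, Prod.fst_zero, star_zero]
    | add x y _ _ hx hy => rw [map_add, Prod.snd_add, Prod.fst_add, star_add, hx, hy]
    | smul r x _ hx => rw [map_smul, Prod.smul_snd, Prod.smul_fst, Quaternion.star_smul, hx]
  · intro h
    have : x = cliffVecOf (cliffFourEquiv x).1 := by
      apply cliffFourEquiv.injective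
      rw [cliffFourEquiv_vecOf, ← h]
    rw [this]
    exact cliffVecOf_mem _

/-- The inclusion of the Lipschitz quaternions in the real quaternions. -/
def LipschitzQuaternion.toReal : LipschitzQuaternion →+* ℍ[ℝ] where
  toFun q := ⟨q.re, q.imI, q.imJ, q.imK⟩
  map_one' := Quaternion.ext _ _ Int.cast_one Int.cast_zero Int.cast_zero Int.cast_zero
  map_zero' := Quaternion.ext _ _ Int.cast_zero Int.cast_zero Int.cast_zero Int.cast_zero
  map_add' _ _ :=
    Quaternion.ext _ _ (Int.cast_add _ _) (Int.cast_add _ _) (Int.cast_add _ _) (Int.cast_add _ _)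
  map_mul' _ _ := by
    apply Quaternion.ext
    · refine Eq.trans ?_ (Quaternion.re_mul _ _).symm
      simp only [Quaternion.re_mul, Int.cast_add, Int.cast_sub, Int.cast_mul]
    · refine Eq.trans ?_ (Quaternion.imI_mul _ _).symm
      simp only [Quaternion.imI_mul, Int.cast_add, Int.cast_sub, Int.cast_mul]
    · refine Eq.trans ?_ (Quaternion.imJ_mul _ _).symm
      simp only [Quaternion.imJ_mul, Int.cast_add, Int.cast_sub, Int.cast_mul]
    · refine Eq.trans ?_ (Quaternion.imK_mul _ _).symm
      simp only [Quaternion.imK_mul, Int.cast_add, Int.cast_sub, Int.cast_mul]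

namespace LipschitzQuaternion

theorem toReal_injective : Function.Injective toReal := fun _ _ h =>
  Quaternion.ext _ _ (Int.cast_injective (congrArg QuaternionAlgebra.re h))
    (Int.cast_injective (congrArg QuaternionAlgebra.imI h))
    (Int.cast_injective (congrArg QuaternionAlgebra.imJ h))
    (Int.cast_injective (congrArg QuaternionAlgebra.imK h))

theorem toReal_star (q : LipschitzQuaternion) : toReal (star q) = star (toReal q) := by
  have h : ∀ p : ℍ[ℝ], star p = (⟨p.re, -p.imI, -p.imJ, -p.imK⟩ : ℍ[ℝ]) := fun p => by
    apply Quaternion.ext <;> simp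
  rw [h]
  apply Quaternion.ext
  · exact congrArg Int.cast (re_star q)
  · exact (congrArg Int.cast (imI_star q)).trans (Int.cast_neg _)
  · exact (congrArg Int.cast (imJ_star q)).trans (Int.cast_neg _)
  · exact (congrArg Int.cast (imK_star q)).trans (Int.cast_neg _)

theorem normSq_toReal (q : LipschitzQuaternion) : normSq (toReal q) = (normSq q : ℤ) := by
  rw [normSq_def', normSq_def']
  push_cast
  rfl

end LipschitzQuaternion

open LipschitzQuaternion

theorem imVec_single_eq_toReal : imVec (Pi.single 0 1) = toReal unitI ∧
    imVec (Pi.single 1 1) = toReal unitJ ∧ imVec (Pi.single 2 1) = toReal unitK := by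
  obtain ⟨⟨a0, a1, a2, a3⟩, ⟨b0, b1, b2, b3⟩, c0, c1, c2, c3⟩ := imVec_single
  refine ⟨Quaternion.ext _ _ (a0.trans Int.cast_zero.symm) (a1.trans Int.cast_one.symm)
    (a2.trans Int.cast_zero.symm) (a3.trans Int.cast_zero.symm),
    Quaternion.ext _ _ (b0.trans Int.cast_zero.symm) (b1.trans Int.cast_zero.symm)
    (b2.trans Int.cast_one.symm) (b3.trans Int.cast_zero.symm),
    Quaternion.ext _ _ (c0.trans Int.cast_zero.symm) (c1.trans Int.cast_zero.symm)
    (c2.trans Int.cast_zero.symm) (c3.trans Int.cast_one.symm)⟩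

theorem exists_imVec_single_eq_toReal (h : Fin (4 - 1)) :
    ∃ q : LipschitzQuaternion, imVec (Pi.single h 1) = toReal q ∧ star q = -q := by
  obtain ⟨e0, e1, e2⟩ := imVec_single_eq_toReal
  obtain rfl | rfl | rfl : h = 0 ∨ h = 1 ∨ h = 2 := by
    revert h; decide
  exacts [⟨_, e0, rfl⟩, ⟨_, e1, rfl⟩, ⟨_, e2, rfl⟩]

theorem mem_cliffVecInt_four (x : Cliff 4) :
    x ∈ cliffVecInt 4 ↔ ∃ q, x = cliffVecOf (toReal q) := by
  constructor
  · intro h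
    suffices ∃ q, cliffFourEquiv x = (toReal q, star (toReal q)) by
      obtain ⟨q, hq⟩ := this
      exact ⟨q, cliffFourEquiv.injective (by rw [hq, cliffFourEquiv_vecOf])⟩
    induction h using Submodule.span_induction with
    | mem x hx =>
      rcases hx with rfl | ⟨h, rfl⟩
      · exact ⟨1, by rw [map_one, map_one, star_one]; rfl⟩
      · obtain ⟨q, hq, hq'⟩ := exists_imVec_single_eq_toReal h
        exact ⟨q, by rw [cliffFourEquiv_gen, hq, ← toReal_star, hq', map_neg]⟩
    | zero => exact ⟨0, by rw [map_zero, map_zero, star_zero]; rfl⟩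
    | add x y _ _ hx hy =>
      obtain ⟨q, hq⟩ := hx
      obtain ⟨r, hr⟩ := hy
      exact ⟨q + r, by rw [map_add, map_add, hq, hr, star_add]; rfl⟩
    | smul n x _ hx =>
      obtain ⟨q, hq⟩ := hx
      exact ⟨n • q, by rw [map_zsmul, map_zsmul, hq, star_zsmul]; rfl⟩
  · rintro ⟨q, rfl⟩
    have h1 : (1 : Cliff 4) ∈ cliffVecInt 4 := Submodule.subset_span (Set.mem_insert _ _)
    have h2 : ∀ h, cliffGen 4 h ∈ cliffVecInt 4 := fun h =>
      Submodule.subset_span (Set.mem_insert_of_mem _ ⟨h, rfl⟩)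
    have h3 : cliffVecOf (toReal q) = q.re • 1 + q.imI • cliffGen 4 0 + q.imJ • cliffGen 4 1 +
        q.imK • cliffGen 4 2 := by
      simp only [← Int.cast_smul_eq_zsmul ℝ]
      rfl
    rw [h3]
    exact add_mem (add_mem (add_mem (Submodule.smul_mem _ _ h1) (Submodule.smul_mem _ _ (h2 0)))
      (Submodule.smul_mem _ _ (h2 1))) (Submodule.smul_mem _ _ (h2 2))

theorem cliffFourEven_toReal_mem (q : LipschitzQuaternion) :
    cliffFourEven (toReal q) ∈ CliffInt 4 := by
  have h2 : ∀ h, cliffGen 4 h ∈ CliffInt 4 := fun h => Subring.subset_closure ⟨h, rfl⟩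
  have h3 : cliffFourEven (toReal q) = q.re • 1 + q.imI • (cliffGen 4 1 * cliffGen 4 2) +
      q.imJ • -(cliffGen 4 0 * cliffGen 4 2) + q.imK • (cliffGen 4 0 * cliffGen 4 1) := by
    simp only [← Int.cast_smul_eq_zsmul ℝ]
    rw [← Algebra.algebraMap_eq_smul_one]
    rfl
  rw [h3]
  exact add_mem (add_mem (add_mem (zsmul_mem (one_mem _) _)
    (zsmul_mem (mul_mem (h2 1) (h2 2)) _)) (zsmul_mem (neg_mem (mul_mem (h2 0) (h2 2))) _))
    (zsmul_mem (mul_mem (h2 0) (h2 1)) _)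

/-- The congruent pairs form a subring containing the generators (q, star q), because conjugation
only changes signs. Conversely, for q = p + 2r the pair (p, q) is the diagonal element p + r plus
(-1, 1) times the diagonal element r. -/
theorem mem_CliffInt_four (x : Cliff 4) : x ∈ CliffInt 4 ↔
    ∃ p q, modTwo p = modTwo q ∧ cliffFourEquiv x = (toReal p, toReal q) := by
  constructor
  · intro h
    induction h using Subring.closure_induction with
    | mem x hx =>
      obtain ⟨h, rfl⟩ := hx
      obtain ⟨q, hq, hq'⟩ := exists_imVec_single_eq_toReal h
      exact ⟨q, star q, (modTwo_star q).symm, by rw [cliffFourEquiv_gen, hq, hq', map_neg]⟩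
    | zero => exact ⟨0, 0, rfl, by rw [map_zero, map_zero]; rfl⟩
    | one => exact ⟨1, 1, rfl, by rw [map_one, map_one]; rfl⟩
    | add x y _ _ hx hy =>
      obtain ⟨p, q, h, e⟩ := hx
      obtain ⟨p', q', h', e'⟩ := hy
      exact ⟨p + p', q + q', by rw [map_add, map_add, h, h'], by
        rw [map_add, map_add, map_add, e, e']; rfl⟩
    | neg x _ hx =>
      obtain ⟨p, q, h, e⟩ := hx
      exact ⟨-p, -q, by rw [map_neg, map_neg, h], by rw [map_neg, map_neg, map_neg, e]; rfl⟩
    | mul x y _ _ hx hy =>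
      obtain ⟨p, q, h, e⟩ := hx
      obtain ⟨p', q', h', e'⟩ := hy
      exact ⟨p * p', q * q', by rw [map_mul, map_mul, h, h'], by
        rw [map_mul, map_mul, map_mul, e, e']; rfl⟩
  · rintro ⟨p, q, h, e⟩
    obtain ⟨⟨r₀, e₀⟩, ⟨r₁, e₁⟩, ⟨r₂, e₂⟩, ⟨r₃, e₃⟩⟩ := modTwo_eq_iff.1 h
    obtain ⟨r, hr⟩ : ∃ r : LipschitzQuaternion, q = p + (r + r) := by
      refine ⟨⟨r₀, r₁, r₂, r₃⟩, Quaternion.ext _ _ ?_ ?_ ?_ ?_⟩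
      · change q.re = p.re + (r₀ + r₀); omega
      · change q.imI = p.imI + (r₁ + r₁); omega
      · change q.imJ = p.imJ + (r₂ + r₂); omega
      · change q.imK = p.imK + (r₃ + r₃); omega
    have hx : x = cliffFourEven (toReal (p + r)) + cliffOmega * cliffFourEven (toReal r) := by
      apply cliffFourEquiv.injective
      have h1 : ∀ y, cliffFourEquiv (cliffFourEven y) = (y, y) := cliffFourHom_even
      have h2 : cliffFourEquiv cliffOmega = (-1, 1) := cliffFourHom_omega
      rw [e, map_add, map_mul, h1, h1, h2, hr]
      simp only [map_add]
      apply Prod.ext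
      · simp
      · simp [add_assoc]
    rw [hx]
    have h2 : ∀ h, cliffGen 4 h ∈ CliffInt 4 := fun h => Subring.subset_closure ⟨h, rfl⟩
    exact add_mem (cliffFourEven_toReal_mem _)
      (mul_mem (mul_mem (mul_mem (h2 0) (h2 1)) (h2 2)) (cliffFourEven_toReal_mem _))

end CliffFourSubsets

/-! ### The real Clifford group as the pairs of equal norm -/

noncomputable section CliffordGroupFour

open Quaternion

/-- A real quaternion of norm one different from `-1` is a commutator. -/
theorem Quaternion.exists_mul_eq_mul_mul {u : ℍ[ℝ]} (hu : normSq u = 1) (hu' : u ≠ -1) :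
    ∃ x y : ℍ[ℝ], x ≠ 0 ∧ y ≠ 0 ∧ y * x = x * y * u := by
  -- An imaginary quaternion orthogonal to the imaginary part of `u`. Then `y` and `y * u` are both
  -- imaginary of the same norm, so they have the same square, and x = y + yu satisfies xyu = y(yu)
  -- + y² = yx.
  obtain ⟨y, hy, hre, hre'⟩ : ∃ y : ℍ[ℝ], y ≠ 0 ∧ y.re = 0 ∧ (y * u).re = 0 := by
    by_cases h : u.imI = 0
    · refine ⟨imVec (Pi.single 0 1), fun h0 => ?_, rfl, ?_⟩
      · have := congrArg QuaternionAlgebra.imI h0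
        rw [imVec_single.1.2.1] at this
        exact one_ne_zero this
      · obtain ⟨⟨a0, a1, a2, a3⟩, -⟩ := imVec_single
        rw [re_mul, a0, a1, a2, a3, h]
        ring
    · refine ⟨imVec ![-u.imJ, u.imI, 0], fun h0 => ?_, rfl, ?_⟩
      · exact h (congrArg QuaternionAlgebra.imJ h0)
      · rw [re_mul, re_imVec, imI_imVec, imJ_imVec, imK_imVec]
        change 0 * u.re - -u.imJ * u.imI - u.imI * u.imJ - 0 * u.imK = 0
        ring
  have h1 := mul_self_of_re_eq_zero hre
  have h2 := mul_self_of_re_eq_zero hre'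
  rw [map_mul, hu, mul_one, ← h1] at h2
  refine ⟨y + y * u, y, fun h => hu' ?_, hy, ?_⟩
  · have h3 : y * (1 + u) = 0 := by rw [mul_add, mul_one, h]
    rw [eq_neg_iff_add_eq_zero, add_comm]
    exact (mul_eq_zero.1 h3).resolve_left hy
  · rw [mul_add, add_mul, add_mul, mul_assoc (y * u), h2, add_comm, ← mul_assoc]

/-- The invertible vector with the coordinates of a given quaternion. -/
def cliffVecUnit (p : ℍ[ℝ]) (hp : p ≠ 0) : (Cliff 4)ˣ where
  val := cliffVecOf p
  inv := cliffVecOf p⁻¹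
  val_inv := cliffFourEquiv.injective (by
    rw [map_mul, cliffFourEquiv_vecOf, cliffFourEquiv_vecOf, map_one, Prod.mk_mul_mk, ← star_mul,
      mul_inv_cancel₀ hp, inv_mul_cancel₀ hp, star_one]
    rfl)
  inv_val := cliffFourEquiv.injective (by
    rw [map_mul, cliffFourEquiv_vecOf, cliffFourEquiv_vecOf, map_one, Prod.mk_mul_mk, ← star_mul,
      mul_inv_cancel₀ hp, inv_mul_cancel₀ hp, star_one]
    rfl)

theorem cliffVecUnit_mem (p : ℍ[ℝ]) (hp : p ≠ 0) : cliffVecUnit p hp ∈ cliffGroup 4 :=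
  Subgroup.subset_closure (cliffVecOf_mem p)

theorem cliffFourEquiv_vecUnit (p : ℍ[ℝ]) (hp : p ≠ 0) :
    cliffFourEquiv (cliffVecUnit p hp : (Cliff 4)ˣ) = (p, star p) := cliffFourEquiv_vecOf p

theorem cliffFourEquiv_vecUnit_inv (p : ℍ[ℝ]) (hp : p ≠ 0) :
    cliffFourEquiv ((cliffVecUnit p hp)⁻¹ : (Cliff 4)ˣ) = (p⁻¹, star p⁻¹) := cliffFourEquiv_vecOf _

/-- Vectors are pairs (p, star p). For u = y⁻¹x⁻¹yx, multiplying the inverses of the vectors of star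
y and star x by the vector of their product star x · star y leaves 1 in the first component and u in
the second. -/
theorem exists_mem_cliffGroup_one {u : ℍ[ℝ]} (hu : normSq u = 1) :
    ∃ g ∈ cliffGroup 4, cliffFourEquiv (g : (Cliff 4)ˣ) = (1, u) := by
  by_cases hu' : u = -1
  · subst hu'
    have hne : ∀ h, imVec (Pi.single h 1) ≠ 0 := fun h h0 => by
      have h1 := imVec_mul_self (Pi.single h 1)
      have h2 : cliffFourEquiv (cliffGen 4 h) = 0 := by rw [cliffFourEquiv_gen, h0, neg_zero]; rfl
      have h3 := cliffGen_mul_self h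
      rw [(map_eq_zero_iff _ cliffFourEquiv.injective).1 h2, mul_zero] at h3
      have h4 := congrArg cliffFourEquiv h3
      rw [map_zero, map_neg, map_one] at h4
      exact one_ne_zero (neg_eq_zero.1 h4.symm)
    -- The product of the three generators is (-1, 1), so its negative is (1, -1).
    refine ⟨cliffVecUnit (-1) (neg_ne_zero.2 one_ne_zero) * (cliffVecUnit _ (hne 0) *
      cliffVecUnit _ (hne 1) * cliffVecUnit _ (hne 2)), mul_mem (cliffVecUnit_mem _ _)
        (mul_mem (mul_mem (cliffVecUnit_mem _ _) (cliffVecUnit_mem _ _)) (cliffVecUnit_mem _ _)), ?_⟩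
    have h := cliffFourHom_omega
    simp only [cliffOmega, map_mul, cliffFourHom_gen] at h
    rw [Units.val_mul, Units.val_mul, Units.val_mul, map_mul, map_mul, map_mul,
      cliffFourEquiv_vecUnit, cliffFourEquiv_vecUnit, cliffFourEquiv_vecUnit,
      cliffFourEquiv_vecUnit, star_imVec, star_imVec, star_imVec, h]
    simp
  · obtain ⟨x, y, hx, hy, hxy⟩ := exists_mul_eq_mul_mul hu hu'
    have hx' : star x ≠ 0 := star_ne_zero.2 hx
    have hy' : star y ≠ 0 := star_ne_zero.2 hy
    refine ⟨(cliffVecUnit (star y) hy')⁻¹ * (cliffVecUnit (star x) hx')⁻¹ *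
      cliffVecUnit (star x * star y) (mul_ne_zero hx' hy'),
      mul_mem (mul_mem (inv_mem (cliffVecUnit_mem _ _)) (inv_mem (cliffVecUnit_mem _ _)))
        (cliffVecUnit_mem _ _), ?_⟩
    rw [Units.val_mul, Units.val_mul, map_mul, map_mul, cliffFourEquiv_vecUnit,
      cliffFourEquiv_vecUnit_inv, cliffFourEquiv_vecUnit_inv, ← star_mul, star_star, Prod.mk_mul_mk,
      Prod.mk_mul_mk]
    apply Prod.ext
    · change (star y)⁻¹ * (star x)⁻¹ * star (y * x) = 1
      rw [star_mul, mul_assoc, inv_mul_cancel_left₀ hx', inv_mul_cancel₀ hy']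
    · change star (star y)⁻¹ * star (star x)⁻¹ * (y * x) = u
      rw [hxy, star_inv₀, star_inv₀, star_star, star_star, mul_assoc, mul_assoc x,
        inv_mul_cancel_left₀ hx, inv_mul_cancel_left₀ hy]

/-- Equality of the two norms is multiplicative and holds for vectors. Conversely, a pair (p, q) of
equal nonzero norms is the vector (p, star p) times (1, u) with N(u) = 1. -/
theorem mem_insert_GammaReal_four (x : Cliff 4) : x ∈ insert 0 (GammaReal 4) ↔
    normSq (cliffFourEquiv x).1 = normSq (cliffFourEquiv x).2 := by
  constructor
  · rintro (rfl | ⟨u, hu, rfl⟩)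
    · rw [map_zero]; rfl
    · let F : (Cliff 4)ˣ →* ℍ[ℝ] × ℍ[ℝ] :=
        (cliffFourEquiv : Cliff 4 →* ℍ[ℝ] × ℍ[ℝ]).comp (Units.coeHom (Cliff 4))
      let F₁ : (Cliff 4)ˣ →* ℝ := (MonoidWithZeroHom.toMonoidHom normSq).comp ((MonoidHom.fst _ _).comp F)
      let F₂ : (Cliff 4)ˣ →* ℝ := (MonoidWithZeroHom.toMonoidHom normSq).comp ((MonoidHom.snd _ _).comp F)
      have h : cliffGroup 4 ≤ F₁.eqLocus F₂ := by
        rw [cliffGroup, Subgroup.closure_le]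
        intro v hv
        change normSq (cliffFourEquiv v).1 = normSq (cliffFourEquiv v).2
        rw [(mem_cliffVec_four _).1 hv, normSq_star]
      exact h hu
  · intro h
    obtain ⟨p, q, e⟩ : ∃ p q, cliffFourEquiv x = (p, q) := ⟨_, _, rfl⟩
    rw [e] at h
    change normSq p = normSq q at h
    by_cases hp : p = 0
    · left
      rw [hp, map_zero, eq_comm, normSq_eq_zero] at h
      apply cliffFourEquiv.injective
      rw [e, hp, h, map_zero]
      rfl
    · right
      have hp' : star p ≠ 0 := star_ne_zero.2 hp
      obtain ⟨g, hg, hg'⟩ := exists_mem_cliffGroup_one (u := (star p)⁻¹ * q) (by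
        rw [map_mul, normSq_inv, normSq_star, h, inv_mul_cancel₀ (h ▸ normSq_ne_zero.2 hp)])
      refine ⟨cliffVecUnit p hp * g, mul_mem (cliffVecUnit_mem _ _) hg, ?_⟩
      apply cliffFourEquiv.injective
      rw [Units.val_mul, map_mul, cliffFourEquiv_vecUnit, hg', e, Prod.mk_mul_mk, mul_one,
        mul_inv_cancel_left₀ hp']

end CliffordGroupFour

/-! ### The embedding in the matrices over the Clifford algebra -/

noncomputable section CliffordMatrices

open Quaternion LipschitzQuaternion

/-- The involution `(a, b; c, d) ↦ (star d, -star b; -star c, star a)`. -/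
def Matrix.twist {R : Type*} [Ring R] [StarRing R] (X : Matrix (Fin 2) (Fin 2) R) :
    Matrix (Fin 2) (Fin 2) R :=
  !![star (X 1 1), -star (X 0 1); -star (X 1 0), star (X 0 0)]

theorem Matrix.twist_mul {R : Type*} [Ring R] [StarRing R] (X Y : Matrix (Fin 2) (Fin 2) R) :
    (X * Y).twist = Y.twist * X.twist := by
  ext i j
  fin_cases i <;> fin_cases j <;> simp [Matrix.twist, Matrix.mul_apply, Fin.sum_univ_two, add_comm]

theorem Matrix.twist_one {R : Type*} [Ring R] [StarRing R] :
    (1 : Matrix (Fin 2) (Fin 2) R).twist = 1 := by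
  simp [Matrix.twist, Matrix.one_fin_two]

theorem Matrix.twist_twist {R : Type*} [Ring R] [StarRing R] (X : Matrix (Fin 2) (Fin 2) R) :
    X.twist.twist = X := by
  ext i j
  fin_cases i <;> fin_cases j <;> simp [Matrix.twist]

/-- The matrix over the Clifford algebra with the entries `(X s t, Y s t)`. -/
def cliffPairMatrix (X Y : Matrix (Fin 2) (Fin 2) LipschitzQuaternion) :
    Matrix (Fin 2) (Fin 2) (Cliff 4) :=
  Matrix.of fun s t => cliffFourEquiv.symm (toReal (X s t), toReal (Y s t))

theorem cliffFourEquiv_pairMatrix (X Y : Matrix (Fin 2) (Fin 2) LipschitzQuaternion) (s t : Fin 2) :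
    cliffFourEquiv (cliffPairMatrix X Y s t) = (toReal (X s t), toReal (Y s t)) :=
  cliffFourEquiv.apply_symm_apply _

theorem cliffPairMatrix_ext {M : Matrix (Fin 2) (Fin 2) (Cliff 4)}
    {X Y : Matrix (Fin 2) (Fin 2) LipschitzQuaternion}
    (h : ∀ s t, cliffFourEquiv (M s t) = (toReal (X s t), toReal (Y s t))) :
    M = cliffPairMatrix X Y := by
  ext s t
  apply cliffFourEquiv.injective
  rw [h, cliffFourEquiv_pairMatrix]

theorem cliffPairMatrix_mul (X Y X' Y' : Matrix (Fin 2) (Fin 2) LipschitzQuaternion) :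
    cliffPairMatrix X Y * cliffPairMatrix X' Y' = cliffPairMatrix (X * X') (Y * Y') := by
  refine cliffPairMatrix_ext fun s t => ?_
  simp only [Matrix.mul_apply, Fin.sum_univ_two, map_add, map_mul, cliffFourEquiv_pairMatrix]
  rfl

theorem cliffPairMatrix_one : cliffPairMatrix 1 1 = 1 := by
  refine (cliffPairMatrix_ext fun s t => ?_).symm
  fin_cases s <;> fin_cases t <;> simp <;> rfl

theorem cliffPairMatrix_injective {X Y X' Y' : Matrix (Fin 2) (Fin 2) LipschitzQuaternion}
    (h : cliffPairMatrix X Y = cliffPairMatrix X' Y') : X = X' := by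
  ext1 s t
  have h1 := congrArg (fun M => (cliffFourEquiv (M s t)).1) h
  simp only [cliffFourEquiv_pairMatrix] at h1
  exact toReal_injective h1

/-- The embedding of the invertible matrices over the Lipschitz quaternions in the invertible
matrices over the Clifford algebra. -/
def cliffEmbedding : GL2 LipschitzQuaternion →* GL2 (Cliff 4) where
  toFun A :=
    { val := cliffPairMatrix A.val A.inv.twist
      inv := cliffPairMatrix A.inv A.val.twist
      val_inv := by
        rw [cliffPairMatrix_mul, ← Matrix.twist_mul, A.val_inv, Matrix.twist_one,
          cliffPairMatrix_one]
      inv_val := by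
        rw [cliffPairMatrix_mul, ← Matrix.twist_mul, A.inv_val, Matrix.twist_one,
          cliffPairMatrix_one] }
  map_one' := Units.ext (by
    change cliffPairMatrix 1 (Matrix.twist 1) = 1
    rw [Matrix.twist_one, cliffPairMatrix_one])
  map_mul' A B := Units.ext (by
    change cliffPairMatrix (A.val * B.val) (B.inv * A.inv).twist =
      cliffPairMatrix A.val A.inv.twist * cliffPairMatrix B.val B.inv.twist
    rw [cliffPairMatrix_mul, Matrix.twist_mul])

theorem coe_cliffEmbedding (A : GL2 LipschitzQuaternion) :
    (cliffEmbedding A).val = cliffPairMatrix A.val A.inv.twist := rfl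

theorem cliffEmbedding_injective : Function.Injective cliffEmbedding := fun _ _ h =>
  Units.ext (cliffPairMatrix_injective (congrArg Units.val h))

theorem inv_matE_twist (x : LipschitzQuaternion) : (matE x).inv.twist = !![star x, 1; -1, 0] := by
  change Matrix.twist !![0, -1; 1, x] = _
  simp [Matrix.twist]

/-- The twisted inverse of E(x) is E(star x), and (x, star x) is the vector with the coordinates of
x. -/
theorem cliffEmbedding_matE (x : LipschitzQuaternion) :
    cliffEmbedding (matE x) = matE (cliffVecOf (toReal x)) := by
  apply Units.ext
  rw [coe_cliffEmbedding, inv_matE_twist]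
  refine (cliffPairMatrix_ext fun s t => ?_).symm
  fin_cases s <;> fin_cases t <;> simp [coe_matE, cliffFourEquiv_vecOf, toReal_star] <;> rfl

theorem map_cliffEmbedding_E2 : (E2 LipschitzQuaternion).map cliffEmbedding = E2Gamma 4 := by
  rw [E2, E2Gamma, MonoidHom.map_closure]
  congr 1
  ext M
  constructor
  · rintro ⟨_, ⟨x, rfl⟩, rfl⟩
    exact ⟨_, (mem_cliffVecInt_four _).2 ⟨x, rfl⟩, (cliffEmbedding_matE x).symm⟩
  · rintro ⟨_, hx, rfl⟩
    obtain ⟨q, rfl⟩ := (mem_cliffVecInt_four _).1 hx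
    exact ⟨_, ⟨q, rfl⟩, cliffEmbedding_matE q⟩

/-! ### Comparison of elementary matrices with SL₊ -/

/-- The relation between the rows `(a, b)` of an elementary matrix and `(c, d)` of its twisted
inverse. -/
def RowCompatible (a b c d : LipschitzQuaternion) : Prop :=
  normSq a = normSq c ∧ normSq b = normSq d ∧ star b * a = star c * d ∧
    modTwo a = modTwo c ∧ modTwo b = modTwo d

/-- Equality of norms alone is not inductive: the norm of ax - b contains the real part of star b ·
a · x. The relation star b · a = star c · d matches this cross term and reproduces itself. -/
theorem RowCompatible.mul_matE {a b c d : LipschitzQuaternion} (h : RowCompatible a b c d)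
    (x : LipschitzQuaternion) : RowCompatible (a * x - b) a (c * star x - d) c := by
  obtain ⟨h1, h2, h3, h4, h5⟩ := h
  have hsub : ∀ p q : LipschitzQuaternion,
      normSq (p - q) = normSq p + normSq q - 2 * (star q * p).re := by
    intro p q
    simp only [normSq_def', re_sub, imI_sub, imJ_sub, imK_sub, re_mul, re_star, imI_star, imJ_star,
      imK_star]
    ring
  have h6 : (star b * (a * x)).re = (star d * (c * star x)).re := by
    rw [← mul_assoc, h3, ← re_star (star d * _)]
    simp only [star_mul, star_star]
    simp only [re_mul, imI_mul, imJ_mul, imK_mul, re_star, imI_star, imJ_star, imK_star]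
    ring
  refine ⟨?_, h1, ?_, ?_, h4⟩
  · rw [hsub, hsub, map_mul, map_mul, normSq_star, h1, h2, h6]
  · have h7 : star a * b = star d * c := by
      have := congrArg star h3
      simpa only [star_mul, star_star] using this
    rw [mul_sub, star_sub, sub_mul, star_mul, star_star, h7, ← mul_assoc, mul_assoc x,
      star_mul_self, star_mul_self, h1, coe_commutes]
  · rw [map_sub, map_sub, map_mul, map_mul, h4, h5, modTwo_star]

theorem rowCompatible_of_mem_E2 {A : GL2 LipschitzQuaternion} (hA : A ∈ E2 LipschitzQuaternion)
    (s : Fin 2) : RowCompatible (A.val s 0) (A.val s 1) (A.inv.twist s 0) (A.inv.twist s 1) := by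
  refine E2_induction (P := fun A => ∀ s, RowCompatible (A.val s 0) (A.val s 1) (A.inv.twist s 0)
    (A.inv.twist s 1)) (fun s => ?_) (fun A x h s => ?_) hA s
  · change RowCompatible ((1 : Matrix (Fin 2) (Fin 2) LipschitzQuaternion) s 0)
      ((1 : Matrix (Fin 2) (Fin 2) LipschitzQuaternion) s 1)
      (Matrix.twist (1 : Matrix (Fin 2) (Fin 2) LipschitzQuaternion) s 0)
      (Matrix.twist (1 : Matrix (Fin 2) (Fin 2) LipschitzQuaternion) s 1)
    rw [Matrix.twist_one]
    fin_cases s <;> simp [RowCompatible]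
  · have e1 : (A * matE x).val = A.val * !![x, 1; -1, 0] := rfl
    have e2 : (A * matE x).inv.twist = A.inv.twist * !![star x, 1; -1, 0] := by
      rw [← inv_matE_twist, ← Matrix.twist_mul]
      rfl
    rw [e1, e2]
    have := (h s).mul_matE x
    simpa [Matrix.mul_apply, Fin.sum_univ_two, sub_eq_add_neg] using this

/-- One-sided inverses are two-sided for matrices over the real quaternions, and the passage to
these is injective. -/
theorem mul_eq_one_comm_lipschitz {X Y : Matrix (Fin 2) (Fin 2) LipschitzQuaternion}
    (h : X * Y = 1) : Y * X = 1 := by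
  have hinj : Function.Injective (toReal.mapMatrix (m := Fin 2)) := fun A B hAB => by
    ext1 s t
    exact toReal_injective (congrFun (congrFun hAB s) t)
  apply hinj
  rw [map_mul, map_one]
  apply mul_eq_one_symm
  rw [← map_mul, h, map_one]

/-- The equation X · twist(Y) = 1 encodes ad* - bc* = 1 on the diagonal and the conditions on ab*,
cd* off it; the reversed product encodes those on c*a, d*b. -/
theorem cliffPairMatrix_mem {X Y : Matrix (Fin 2) (Fin 2) LipschitzQuaternion}
    (hXY : X * Y.twist = 1) (hYX : Y.twist * X = 1)
    (hnorm : ∀ s t, normSq (X s t) = normSq (Y s t))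
    (hmod : ∀ s t, modTwo (X s t) = modTwo (Y s t)) :
    cliffPairMatrix X Y ∈ SLplusGammaInt 4 := by
  have hG : ∀ s t, cliffPairMatrix X Y s t ∈ insert 0 (GammaReal 4) := fun s t => by
    rw [mem_insert_GammaReal_four, cliffFourEquiv_pairMatrix, normSq_toReal, normSq_toReal, hnorm]
  have e : ∀ s t, (X * Y.twist) s t = (1 : Matrix (Fin 2) (Fin 2) LipschitzQuaternion) s t :=
    fun s t => by rw [hXY]
  have e' : ∀ s t, (Y.twist * X) s t = (1 : Matrix (Fin 2) (Fin 2) LipschitzQuaternion) s t :=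
    fun s t => by rw [hYX]
  simp only [Matrix.mul_apply, Fin.sum_univ_two, Matrix.twist] at e e'
  have e00 := e 0 0
  have e01 := e 0 1
  have e10 := e 1 0
  have e11 := congrArg star (e 1 1)
  have f01 := e' 0 1
  have f10 := e' 1 0
  simp at e00 e01 e10 e11 f01 f10
  have hmulrev : ∀ s t s' t', cliffFourEquiv (cliffPairMatrix X Y s t *
      CliffordAlgebra.reverse (cliffPairMatrix X Y s' t')) =
      (toReal (X s t * star (Y s' t')), toReal (Y s t * star (X s' t'))) := fun s t s' t' => by
    rw [map_mul, cliffFourEquiv_reverse, cliffFourEquiv_pairMatrix, cliffFourEquiv_pairMatrix,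
      Prod.mk_mul_mk, map_mul, map_mul, toReal_star, toReal_star]
  have hrevmul : ∀ s t s' t', cliffFourEquiv (CliffordAlgebra.reverse (cliffPairMatrix X Y s t) *
      cliffPairMatrix X Y s' t') =
      (toReal (star (Y s t) * X s' t'), toReal (star (X s t) * Y s' t')) := fun s t s' t' => by
    rw [map_mul, cliffFourEquiv_reverse, cliffFourEquiv_pairMatrix, cliffFourEquiv_pairMatrix,
      Prod.mk_mul_mk, map_mul, map_mul, toReal_star, toReal_star]
  have hdet : cliffPairMatrix X Y 0 0 * CliffordAlgebra.reverse (cliffPairMatrix X Y 1 1) -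
      cliffPairMatrix X Y 0 1 * CliffordAlgebra.reverse (cliffPairMatrix X Y 1 0) = 1 := by
    apply cliffFourEquiv.injective
    rw [map_sub, hmulrev, hmulrev, map_one, Prod.mk_sub_mk, ← map_sub, ← map_sub, sub_eq_add_neg,
      e00, sub_eq_add_neg, add_comm, e11, map_one]
    rfl
  have hvec : ∀ x p q, cliffFourEquiv x = (toReal p, toReal q) → q = star p → x ∈ cliffVec 4 := by
    intro x p q h h'
    rw [mem_cliffVec_four, h, h', toReal_star]
  refine ⟨⟨⟨hG, ⟨1, one_ne_zero, by rw [hdet, map_one]⟩, ?_, ?_, ?_, ?_⟩, hdet⟩, fun s t => ?_⟩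
  · exact hvec _ _ _ (hmulrev 0 0 0 1) (by rw [neg_add_eq_zero.1 e01, star_mul, star_star])
  · exact hvec _ _ _ (hmulrev 1 0 1 1) (by rw [add_neg_eq_zero.1 e10, star_mul, star_star])
  · exact hvec _ _ _ (hrevmul 1 0 0 0) (by rw [neg_add_eq_zero.1 f10, star_mul, star_star])
  · exact hvec _ _ _ (hrevmul 1 1 0 1) (by rw [add_neg_eq_zero.1 f01, star_mul, star_star])
  · rcases hG s t with h | h
    · exact Or.inl h
    · exact Or.inr ⟨(mem_CliffInt_four _).2 ⟨_, _, hmod s t, cliffFourEquiv_pairMatrix X Y s t⟩, h⟩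

/-- The determinant condition and the two row conditions ab*, cd* already give the four entries of X
· twist(Y) = 1. The column conditions are not needed. -/
theorem exists_of_mem_SLplusGammaInt_four {M : Matrix (Fin 2) (Fin 2) (Cliff 4)}
    (hM : M ∈ SLplusGammaInt 4) : ∃ X Y : Matrix (Fin 2) (Fin 2) LipschitzQuaternion,
      M = cliffPairMatrix X Y ∧ X * Y.twist = 1 ∧ ∀ s t, modTwo (X s t) = modTwo (Y s t) := by
  obtain ⟨⟨⟨-, -, h01, h10, -, -⟩, hdet⟩, hint⟩ := hM
  have hex : ∀ s t, ∃ p q, modTwo p = modTwo q ∧ cliffFourEquiv (M s t) = (toReal p, toReal q) := by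
    intro s t
    rcases hint s t with h | h
    · exact ⟨0, 0, rfl, by rw [h, map_zero, map_zero]; rfl⟩
    · exact (mem_CliffInt_four _).1 h.1
  choose X Y hmod hXY using hex
  have hmulrev : ∀ s t s' t', cliffFourEquiv (M s t * CliffordAlgebra.reverse (M s' t')) =
      (toReal (X s t * star (Y s' t')), toReal (Y s t * star (X s' t'))) := fun s t s' t' => by
    rw [map_mul, cliffFourEquiv_reverse, hXY, hXY,
      Prod.mk_mul_mk, map_mul, map_mul, toReal_star, toReal_star]
  refine ⟨Matrix.of X, Matrix.of Y, cliffPairMatrix_ext hXY, ?_, hmod⟩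
  rw [mem_cliffVec_four, hmulrev, ← toReal_star] at h01 h10
  have e01 := toReal_injective h01
  have e10 := toReal_injective h10
  have hdet' := congrArg cliffFourEquiv hdet
  rw [map_sub, hmulrev, hmulrev, map_one, Prod.mk_sub_mk, ← map_sub, ← map_sub] at hdet'
  have e00 := toReal_injective ((congrArg Prod.fst hdet').trans (map_one toReal).symm)
  have e11 := congrArg star (toReal_injective ((congrArg Prod.snd hdet').trans (map_one toReal).symm))
  have e01' := congrArg star e01
  have e10' := congrArg star e10
  simp only [star_mul, star_star, star_sub, star_one] at e11 e01' e10'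
  ext1 s t
  rw [Matrix.mul_apply, Fin.sum_univ_two]
  fin_cases s <;> fin_cases t <;> simp [Matrix.twist]
  · rw [← sub_eq_add_neg, e00]
  · rw [e01', neg_add_cancel]
  · rw [← e10', add_neg_cancel]
  · rw [neg_add_eq_sub, e11]

theorem coe_E2Gamma_four : Units.val '' (E2Gamma 4 : Set (GL2 (Cliff 4))) = SLplusGammaInt 4 := by
  rw [← map_cliffEmbedding_E2]
  ext M
  constructor
  · rintro ⟨_, ⟨A, hA, rfl⟩, rfl⟩
    have h := rowCompatible_of_mem_E2 hA
    refine cliffPairMatrix_mem (by rw [Matrix.twist_twist]; exact A.val_inv)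
      (by rw [Matrix.twist_twist]; exact A.inv_val) (fun s t => ?_) fun s t => ?_
    · fin_cases t
      exacts [(h s).1, (h s).2.1]
    · fin_cases t
      exacts [(h s).2.2.2.1, (h s).2.2.2.2]
  · intro hM
    obtain ⟨X, Y, rfl, hXY, hmod⟩ := exists_of_mem_SLplusGammaInt_four hM
    let A : GL2 LipschitzQuaternion := ⟨X, Y.twist, hXY, mul_eq_one_comm_lipschitz hXY⟩
    refine ⟨cliffEmbedding A, ⟨A, ?_, rfl⟩, ?_⟩
    -- Modulo 2 conjugation is trivial and Y ≡ X, so twist(Y) is the adjugate of X and the corner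
    -- entry of X · twist(Y) = 1 says that the determinant is 1.
    · rw [SetLike.mem_coe, ← ker_detModTwo, MonoidHom.mem_ker]
      apply Units.ext
      rw [coe_detModTwo]
      have h := congrArg modTwo (congrFun (congrFun hXY 0) 0)
      rw [Matrix.mul_apply, Fin.sum_univ_two] at h
      simp only [Matrix.twist, Matrix.of_apply, Matrix.cons_val', Matrix.cons_val_zero,
        Matrix.cons_val_one, Matrix.cons_val_fin_one, map_add, map_mul, map_neg, modTwo_star,
        ← hmod, Matrix.one_apply_eq, map_one] at h
      rw [map_sub, map_mul, map_mul, sub_eq_add_neg, ← mul_neg]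
      exact h
    · rw [coe_cliffEmbedding]
      change cliffPairMatrix X Y.twist.twist = _
      rw [Matrix.twist_twist]

/-- The elementary groups of the Lipschitz quaternions and of the Clifford algebra with three
generators are isomorphic. -/
def E2EquivE2Gamma : E2 LipschitzQuaternion ≃* E2Gamma 4 :=
  ((E2 LipschitzQuaternion).equivMapOfInjective cliffEmbedding cliffEmbedding_injective).trans
    (MulEquiv.subgroupCongr map_cliffEmbedding_E2)

end CliffordMatrices

theorem corollary5p9 :
    (E2 LipschitzQuaternion ≤ SL2Lipschitz ∧
      (E2 LipschitzQuaternion).relIndex SL2Lipschitz = 4) ∧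
    IsNontrivialAmalgam (E2 LipschitzQuaternion) ∧
    ∃ S : Subgroup (GL2 (Cliff 4)),
      Units.val '' (S : Set (GL2 (Cliff 4))) = SLplusGammaInt 4 ∧
      Nonempty (E2 LipschitzQuaternion ≃* S) ∧
      S = E2Gamma 4 :=
  ⟨⟨LipschitzQuaternion.E2_le_SL2Lipschitz, LipschitzQuaternion.relIndex_E2⟩,
    LipschitzQuaternion.isNontrivialAmalgam_E2, E2Gamma 4, coe_E2Gamma_four, ⟨E2EquivE2Gamma⟩, rfl⟩
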